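/- Let $a>0$, $\gamma\in\mathbb{R}$, $\alpha>0$ and $\mu>\max\{(\gamma+1)/\alpha,\,0\}$. Then for every $x>0$ the series $$g(x)=\sum_{k=0}^{\infty}\frac{(k+a)^\gamma}{(x(k+a)^\alpha+1)^\mu}$$ converges, and $g$ has the following asymptotic expansions as $x\to+0$. Here $\zeta(s,a)$ denotes the Hurwitz zeta function, that is, the analytic continuation to $\mathbb{C}\setminus\{1\}$ of $\sum_{k\ge0}(k+a)^{-s}$ $(\operatorname{Re}s>1)$, and $F(x)\sim L(x)+\sum_{k=0}^\infty c_kx^k$ means that for every integer $N\ge 0$, $F(x)-L(x)-\sum_{k=0}^{N-1}c_kx^k=O(x^N)$ as $x\to+0$. (i) If $-\frac{\gamma+1}{\alpha}$ is not a nonnegative integer, then $$g(x)\sim\frac{\Gamma\left(\frac{\gamma+1}{\alpha}\right)\Gamma\left(\mu-\frac{\gamma+1}{\alpha}\right)}{\alpha\,\Gamma(\mu)}\,x^{-\frac{\gamma+1}{\alpha}}+\sum_{k=0}^{\infty}\frac{(-1)^k}{k!}\,\frac{\Gamma(\mu+k)}{\Gamma(\mu)}\,\zeta(-\alpha k-\gamma,a)\,x^k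 .$$ (ii) If $-\frac{\gamma+1}{\alpha}=r$ is a nonnegative integer, then $$g(x)\sim\frac{\Gamma(\mu+r)(-1)^rx^r}{\Gamma(\mu)\Gamma(r+1)}\left(-\frac{\ln x}{\alpha}+\frac{\Gamma'(r+1)}{\alpha\,\Gamma(r+1)}-\frac{\Gamma'(a)}{\Gamma(a)}-\frac{\Gamma'(\mu+r)}{\alpha\,\Gamma(\mu+r)}\right)+\sum_{k=0,\,k\ne r}^{\infty}\frac{(-1)^k}{k!}\,\frac{\Gamma(\mu+k)}{\Gamma(\mu)}\,\zeta(-\alpha k-\gamma,a)\,x^k .$$ -/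

import Mathlib

open Filter Topology Asymptotics

/-- The Hurwitz zeta function `ζ(s, a)` for real `a > 0`, as a function of `s ∈ ℂ \ {1}`.
Mathlib's `HurwitzZeta.hurwitzZeta` depends only on `a` modulo `1` and is the Hurwitz zeta function
for parameters in `(0, 1]`. Writing `a = p + a₀` with `p ∈ ℕ` and `0 < a₀ ≤ 1`, one removes the first
`p` terms of the series from `ζ(s, a₀)`. The two lemmas below show that this is the
analytic continuation to `ℂ \ {1}` of the series `∑ (k + a) ^ (-s)`, `Re s > 1`. -/
noncomputable def hurwitzZetaPos (s : ℂ) (a : ℝ) : ℂ :=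
  HurwitzZeta.hurwitzZeta (a : UnitAddCircle) s -
    ∑ k ∈ Finset.range (⌈a⌉₊ - 1), 1 / ((k : ℂ) + ((a - (⌈a⌉₊ - 1 : ℕ) : ℝ) : ℂ)) ^ s

theorem hasSum_hurwitzZetaPos {a : ℝ} (ha : 0 < a) {s : ℂ} (hs : 1 < s.re) :
    HasSum (fun k : ℕ => 1 / ((k : ℂ) + (a : ℂ)) ^ s) (hurwitzZetaPos s a) := by
  have hp : 1 ≤ ⌈a⌉₊ := Nat.one_le_iff_ne_zero.mpr (Nat.ceil_pos.mpr ha).ne'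
  have h1 : a ≤ ⌈a⌉₊ := Nat.le_ceil a
  have h2 : (⌈a⌉₊ : ℝ) < a + 1 := Nat.ceil_lt_add_one ha.le
  have hcast : ((⌈a⌉₊ - 1 : ℕ) : ℝ) = (⌈a⌉₊ : ℝ) - 1 := by push_cast [hp]; ring
  have hmem : a - (⌈a⌉₊ - 1 : ℕ) ∈ Set.Icc (0 : ℝ) 1 := by
    rw [hcast]; constructor <;> linarith
  have hcirc : ((a - (⌈a⌉₊ - 1 : ℕ) : ℝ) : UnitAddCircle) = (a : UnitAddCircle) := by
    have h0 : (((⌈a⌉₊ - 1 : ℕ) : ℝ) : UnitAddCircle) = 0 :=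
      (AddCircle.coe_eq_zero_iff 1).mpr ⟨((⌈a⌉₊ - 1 : ℕ) : ℤ), by simp⟩
    rw [AddCircle.coe_sub, h0, sub_zero]
  have h := HurwitzZeta.hasSum_hurwitzZeta_of_one_lt_re hmem hs
  rw [hcirc, ← hasSum_nat_add_iff' (⌈a⌉₊ - 1)] at h
  refine h.congr_fun ?_
  intro k
  push_cast
  ring_nf

theorem differentiableAt_hurwitzZetaPos {a : ℝ} (ha : 0 < a) {s : ℂ} (hs : s ≠ 1) :
    DifferentiableAt ℂ (fun z => hurwitzZetaPos z a) s := by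
  unfold hurwitzZetaPos
  refine (HurwitzZeta.differentiableAt_hurwitzZeta _ hs).sub (DifferentiableAt.fun_sum ?_)
  intro k _
  have hp : 1 ≤ ⌈a⌉₊ := Nat.one_le_iff_ne_zero.mpr (Nat.ceil_pos.mpr ha).ne'
  have h2 : (⌈a⌉₊ : ℝ) < a + 1 := Nat.ceil_lt_add_one ha.le
  have hcast : ((⌈a⌉₊ - 1 : ℕ) : ℝ) = (⌈a⌉₊ : ℝ) - 1 := by push_cast [hp]; ring
  have hpos : 0 < (k : ℝ) + (a - (⌈a⌉₊ - 1 : ℕ)) := by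
    rw [hcast]
    have : (0 : ℝ) ≤ k := k.cast_nonneg
    linarith
  have hne : (k : ℂ) + ((a - (⌈a⌉₊ - 1 : ℕ) : ℝ) : ℂ) ≠ 0 := by
    exact_mod_cast hpos.ne'
  refine (differentiableAt_const _).div (differentiableAt_id.const_cpow (Or.inl hne)) ?_
  rw [Complex.cpow_ne_zero_iff]
  exact Or.inl hne

/-- `F(x) ∼ c 0 + c 1 * x + c 2 * x ^ 2 + ⋯` as `x → +0`, in the sense of Poincaré: each partial sum
approximates `F` up to the order of the first omitted power of `x`. -/
def HasAsymptoticPowerSeries (F : ℝ → ℂ) (c : ℕ → ℂ) : Prop :=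
  ∀ N : ℕ, (fun x : ℝ => F x - ∑ k ∈ Finset.range N, c k * (x : ℂ) ^ k)
    =O[𝓝[>] (0 : ℝ)] fun x : ℝ => x ^ N

/-- The `k`-th term of the series defining `g(x, a, γ, α, μ)`. -/
noncomputable def gTerm (a γ α μ x : ℝ) (k : ℕ) : ℝ :=
  ((k : ℝ) + a) ^ γ / (x * ((k : ℝ) + a) ^ α + 1) ^ μ

/-- `g(x, a, γ, α, μ) = ∑_{k ≥ 0} (k + a) ^ γ / (x (k + a) ^ α + 1) ^ μ`. -/
noncomputable def gSeries (a γ α μ x : ℝ) : ℝ := ∑' k : ℕ, gTerm a γ α μ x k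

/-- The coefficient `((-1) ^ k / k!) (Γ(μ + k) / Γ(μ)) ζ(-α k - γ, a)`. -/
noncomputable def gCoeff (a γ α μ : ℝ) (k : ℕ) : ℂ :=
  (((-1) ^ k / (k.factorial : ℝ) * (Real.Gamma (μ + k) / Real.Gamma μ) : ℝ) : ℂ) *
    hurwitzZetaPos ((-α * k - γ : ℝ) : ℂ) a

/-!
The series is compared with the integral `I(x) = ∫_a^∞ y ^ γ / (x * y ^ α + 1) ^ μ`, and the two
parts `g - I` and `I` are expanded separately as `x → +0`.

*The difference.* By the Euler–Maclaurin formula of order `M`, `g(x) - I(x)` is the sum of boundary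
terms at `a` and of a series of remainders, both linear in the `y`-derivatives of
`y ^ γ * (x * y ^ α + 1) ^ (-μ)`. Subtracting from this function the first `N` terms
`c k * x ^ k * y ^ (γ + α * k)`, `c k = binom (-μ) k`, of its Taylor series in `x` leaves a function
whose `j`-th `y`-derivative is `O(x ^ N * y ^ (γ + α * N - j))`, uniformly in `x`
(`exists_norm_cutoffPowRem_le`). For `M` large the Euler–Maclaurin expression is therefore
`∑_{k < N} c k * x ^ k * Z (γ + α * k) + O(x ^ N)`, where `Z σ` is the Euler–Maclaurin constant of
`y ^ σ` (`exists_norm_gSeries_sub_gIntegral_le`). By analytic continuation in the exponent,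
`Z σ = ζ(-σ, a) + a ^ (σ + 1) / (σ + 1)` for `σ ≠ -1` (`emConst_pow`), while
`Z (-1) = log a - ψ(a)` because `ψ(y) - log y → 0` (`emConst_inv`).

*The integral.* With `p = (γ + 1) / α` the substitution `u = x * y ^ α` turns `I(x)` into
`x ^ (-p) / α` times the incomplete beta integral `∫_ε^∞ u ^ (p - 1) * (1 + u) ^ (-μ)`,
`ε = x * a ^ α`. Its derivative in `ε` shows that it is a constant minus the primitives of
`c k * ε ^ (p + k - 1)`, up to `O(ε ^ (p + N))` (`abs_betaTailReg_sub_le`). The constant is the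
finite part of the integral over `(0, ∞)`. For `p > 0` it is `Γ(p) Γ(μ - p) / Γ(μ)`; integration by
parts, which shifts `(p, μ)` to `(p + 1, μ + 1)`, carries this to all `p` that are not poles of `Γ`
(`tendsto_betaTailReg_of_ne`). At `p = 0` it is `ψ(1) - ψ(μ)`, the limit of `B(p, μ - p) - 1 / p`,
and the same recursion gives the value at `p = -r` (`tendsto_betaTailReg_neg_natCast`).

In the sum, the finite parts `a ^ (σ + 1) / (σ + 1)` cancel; in the exceptional case the two
occurrences of `log a` cancel and `log x` remains.
-/

open Filter Topology Asymptotics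

/-! ### The Euler–Maclaurin formula -/

/-- The coefficients of the boundary terms in the Euler–Maclaurin formula. They equal
`B_{j+1} / (j+1)!`; the value of the Bernoulli polynomial at `1` gives the right sign for
`j = 0` as well. -/
noncomputable def emCoeff (j : ℕ) : ℂ :=
  (-1) ^ (j + 1) * (bernoulliFun (j + 1) 1 : ℂ) / ((j + 1).factorial : ℂ)

/-- The remainder of order `M` in the Euler–Maclaurin formula on the unit interval `[y, y + 1]`,
where `f` stands for the `M`-th derivative. -/
noncomputable def emRem (M : ℕ) (f : ℝ → ℂ) (y : ℝ) : ℂ :=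
  (-1) ^ (M + 1) / (M.factorial : ℂ) * ∫ t in (0 : ℝ)..1, (bernoulliFun M t : ℂ) * f (y + t)

/-- The Euler–Maclaurin constant of order `M` of a function `F 0` with derivatives `F j`: the
limit of `∑_{k < K} F 0 (k + a) - ∫_a^{a + K} F 0` as `K → ∞`. -/
noncomputable def emConst (M : ℕ) (F : ℕ → ℝ → ℂ) (a : ℝ) : ℂ :=
  -∑ j ∈ Finset.range M, emCoeff j * F j a + ∑' k : ℕ, emRem M (F M) (k + a)

lemma emRem_eq_add_emRem_succ (M : ℕ) {F G : ℝ → ℂ} {y : ℝ}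
    (hF : ∀ t ∈ Set.Icc y (y + 1), HasDerivAt F (G t) t) (hG : ContinuousOn G (Set.Icc y (y + 1))) :
    emRem M F y = (-1) ^ (M + 1) / ((M + 1).factorial : ℂ) *
      ((bernoulliFun (M + 1) 1 : ℂ) * F (y + 1) - (bernoulliFun (M + 1) 0 : ℂ) * F y)
      + emRem (M + 1) G y := by
  have hmaps : Set.MapsTo (fun t : ℝ => y + t) (Set.uIcc 0 1) (Set.Icc y (y + 1)) := by
    intro t ht
    rw [Set.uIcc_of_le zero_le_one] at ht
    constructor <;> linarith [ht.1, ht.2]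
  have hG' : ContinuousOn (fun t : ℝ => G (y + t)) (Set.uIcc 0 1) :=
    hG.comp (by fun_prop) hmaps
  have hb (m : ℕ) : Continuous fun t : ℝ => (bernoulliFun m t : ℂ) :=
    Complex.continuous_ofReal.comp (continuous_bernoulliFun m)
  have hparts := intervalIntegral.integral_mul_deriv_eq_deriv_mul (a := (0 : ℝ)) (b := 1)
    (u := fun t : ℝ => (bernoulliFun (M + 1) t : ℂ)) (v := fun t => F (y + t))
    (u' := fun t : ℝ => ((M + 1 : ℕ) : ℂ) * (bernoulliFun M t : ℂ)) (v' := fun t => G (y + t))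
    (fun t _ => by simpa using (hasDerivAt_bernoulliFun (M + 1) t).ofReal_comp)
    (fun t ht => by simpa using (hF _ (hmaps ht)).comp_const_add y t)
    ((continuous_const.mul (hb M)).intervalIntegrable _ _) hG'.intervalIntegrable
  simp only [mul_assoc, intervalIntegral.integral_const_mul, add_zero] at hparts
  have hM : ((M + 1 : ℕ) : ℂ) ≠ 0 := by exact_mod_cast M.succ_ne_zero
  have hf : (M.factorial : ℂ) ≠ 0 := by exact_mod_cast M.factorial_ne_zero
  simp only [emRem, Nat.factorial_succ, Nat.cast_mul, hparts]
  field_simp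
  ring

/-- The Euler–Maclaurin formula of order `M + 1` on the unit interval `[y, y + 1]`. -/
lemma eq_integral_add_emRem (M : ℕ) {F : ℕ → ℝ → ℂ} {y : ℝ}
    (hF : ∀ j, ∀ t ∈ Set.Icc y (y + 1), HasDerivAt (F j) (F (j + 1) t) t) :
    F 0 y = (∫ t in y..y + 1, F 0 t) +
      ∑ j ∈ Finset.range (M + 1), emCoeff j * (F j (y + 1) - F j y) +
      emRem (M + 1) (F (M + 1)) y := by
  have hc (j : ℕ) : ContinuousOn (F j) (Set.Icc y (y + 1)) := fun t ht =>
    (hF j t ht).continuousAt.continuousWithinAt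
  induction M with
  | zero =>
    have h := emRem_eq_add_emRem_succ 0 (hF 0) (hc 1)
    have h0 : emRem 0 (F 0) y = -∫ t in y..y + 1, F 0 t := by
      simp [emRem, intervalIntegral.integral_comp_add_left (fun t => F 0 t) y]
    rw [h0] at h
    simp only [zero_add, pow_one, Nat.factorial_one, bernoulliFun_one] at h
    simp only [zero_add, Finset.sum_range_one, emCoeff, bernoulliFun_one, pow_one,
      Nat.factorial_one]
    push_cast at h ⊢
    linear_combination h
  | succ M ih =>
    have h := emRem_eq_add_emRem_succ (M + 1) (hF (M + 1)) (hc (M + 2))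
    rw [← bernoulliFun_endpoints_eq_of_ne_one (by omega : M + 1 + 1 ≠ 1)] at h
    rw [Finset.sum_range_succ]
    have e : emCoeff (M + 1) * (F (M + 1) (y + 1) - F (M + 1) y) =
        (-1) ^ (M + 1 + 1) / ((M + 1 + 1).factorial : ℂ) *
        ((bernoulliFun (M + 1 + 1) 1 : ℂ) * F (M + 1) (y + 1) -
          (bernoulliFun (M + 1 + 1) 1 : ℂ) * F (M + 1) y) := by
      simp only [emCoeff]; ring
    rw [e]
    linear_combination ih + h

lemma exists_norm_emRem_le (M : ℕ) : ∃ C : ℝ, 0 ≤ C ∧ ∀ (f : ℝ → ℂ) (y B : ℝ),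
    (∀ t ∈ Set.Icc (0 : ℝ) 1, ‖f (y + t)‖ ≤ B) → ‖emRem M f y‖ ≤ C * B := by
  obtain ⟨D, hD⟩ := isCompact_Icc.exists_bound_of_continuousOn
    (continuous_bernoulliFun M).continuousOn (s := Set.Icc (0 : ℝ) 1)
  have hD0 : 0 ≤ D := (norm_nonneg _).trans (hD 0 (by simp))
  refine ⟨(M.factorial : ℝ)⁻¹ * D, by positivity, fun f y B hf => ?_⟩
  have h := intervalIntegral.norm_integral_le_of_norm_le_const (a := (0 : ℝ)) (b := 1)
    (f := fun t => (bernoulliFun M t : ℂ) * f (y + t)) (C := D * B) (fun t ht => by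
      rw [Set.uIoc_of_le zero_le_one] at ht
      have ht' : t ∈ Set.Icc (0 : ℝ) 1 := ⟨ht.1.le, ht.2⟩
      rw [norm_mul, Complex.norm_real]
      exact mul_le_mul (hD t ht') (hf t ht') (norm_nonneg _) hD0)
  simp only [sub_zero, abs_one, mul_one] at h
  rw [emRem, norm_mul, norm_div, norm_pow, norm_neg, norm_one, one_pow, one_div, mul_assoc,
    RCLike.norm_natCast]
  gcongr

lemma summable_add_rpow {a q : ℝ} (ha : 0 < a) (hq : q < -1) :
    Summable fun k : ℕ => ((k : ℝ) + a) ^ q := by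
  refine ((Real.summable_one_div_nat_add_rpow a (-q)).mpr (by linarith)).congr fun k => ?_
  have : 0 < (k : ℝ) + a := by positivity
  rw [abs_of_pos this, Real.rpow_neg this.le, one_div, inv_inv]

lemma norm_emRem_le_of_rpow {M : ℕ} {C : ℝ} (hC : ∀ (f : ℝ → ℂ) (y B : ℝ),
      (∀ t ∈ Set.Icc (0 : ℝ) 1, ‖f (y + t)‖ ≤ B) → ‖emRem M f y‖ ≤ C * B)
    {f : ℝ → ℂ} {D q : ℝ} (hD : 0 ≤ D) (hq : q ≤ 0) (hf : ∀ y, 0 < y → ‖f y‖ ≤ D * y ^ q)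
    {y : ℝ} (hy : 0 < y) : ‖emRem M f y‖ ≤ C * D * y ^ q := by
  rw [mul_assoc]
  exact hC f y _ fun t ht => (hf _ (by linarith [ht.1])).trans <|
    mul_le_mul_of_nonneg_left (Real.rpow_le_rpow_of_nonpos hy (by linarith [ht.1]) hq) hD

lemma summable_emRem {M : ℕ} {f : ℝ → ℂ} {D q a : ℝ} (ha : 0 < a) (hD : 0 ≤ D) (hq : q < -1)
    (hf : ∀ y, 0 < y → ‖f y‖ ≤ D * y ^ q) : Summable fun k : ℕ => emRem M f (k + a) := by
  obtain ⟨C, hC0, hC⟩ := exists_norm_emRem_le M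
  refine Summable.of_norm_bounded ((summable_add_rpow ha hq).mul_left (C * D)) fun k => ?_
  exact norm_emRem_le_of_rpow hC hD (by linarith) hf (by positivity)

/-- The Euler–Maclaurin formula for the difference of a series and an integral over `[a, ∞)`. -/
lemma tendsto_sum_sub_integral_emConst {M : ℕ} {F : ℕ → ℝ → ℂ} {a D q : ℝ} (ha : 0 < a)
    (hM : M ≠ 0) (hF : ∀ j, ∀ t, 0 < t → HasDerivAt (F j) (F (j + 1) t) t)
    (h0 : ∀ j < M, Tendsto (F j) atTop (𝓝 0)) (hD : 0 ≤ D) (hq : q < -1)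
    (hb : ∀ y, 0 < y → ‖F M y‖ ≤ D * y ^ q) :
    Tendsto (fun K : ℕ => ∑ k ∈ Finset.range K, F 0 (k + a) - ∫ t in a..K + a, F 0 t) atTop
      (𝓝 (emConst M F a)) := by
  obtain ⟨M, rfl⟩ := Nat.exists_eq_succ_of_ne_zero hM
  have hint (u v : ℝ) (hu : 0 < u) (hv : 0 < v) :
      IntervalIntegrable (F 0) MeasureTheory.volume u v := by
    refine ContinuousOn.intervalIntegrable fun t ht => ?_
    have : 0 < t := lt_of_lt_of_le (lt_min hu hv) ht.1
    exact (hF 0 t this).continuousAt.continuousWithinAt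
  have key (K : ℕ) : ∑ k ∈ Finset.range K, F 0 (k + a) - ∫ t in a..K + a, F 0 t =
      ∑ j ∈ Finset.range (M + 1), emCoeff j * (F j (K + a) - F j a) +
      ∑ k ∈ Finset.range K, emRem (M + 1) (F (M + 1)) (k + a) := by
    induction K with
    | zero => simp
    | succ K ih =>
      have hK : 0 < (K : ℝ) + a := by positivity
      have h := eq_integral_add_emRem M (F := F) (y := K + a) fun j t ht => hF j t
        (lt_of_lt_of_le hK ht.1)
      have hsplit := intervalIntegral.integral_add_adjacent_intervals (hint a (K + a) ha hK)
        (hint (K + a) (K + a + 1) hK (by linarith))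
      have hcast : ((K + 1 : ℕ) : ℝ) + a = K + a + 1 := by push_cast; ring
      rw [hcast, ← hsplit, Finset.sum_range_succ (fun k : ℕ => F 0 (k + a)) K,
        Finset.sum_range_succ (fun k : ℕ => emRem (M + 1) (F (M + 1)) (k + a)) K]
      have hs : ∑ j ∈ Finset.range (M + 1), emCoeff j * (F j (K + a + 1) - F j a) =
          ∑ j ∈ Finset.range (M + 1), emCoeff j * (F j (K + a + 1) - F j (K + a)) +
          ∑ j ∈ Finset.range (M + 1), emCoeff j * (F j (K + a) - F j a) := by
        rw [← Finset.sum_add_distrib]; exact Finset.sum_congr rfl fun j _ => by ring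
      rw [hs]
      linear_combination ih + h
  simp only [key]
  refine Tendsto.add ?_ (summable_emRem ha hD hq hb).hasSum.tendsto_sum_nat
  rw [← Finset.sum_neg_distrib]
  refine tendsto_finsetSum _ fun j hj => ?_
  have ht : Tendsto (fun K : ℕ => F j (K + a)) atTop (𝓝 0) :=
    (h0 j (Finset.mem_range.mp hj)).comp
      (tendsto_atTop_add_const_right _ _ tendsto_natCast_atTop_atTop)
  simpa using (ht.sub_const (F j a)).const_mul (emCoeff j)

/-! ### Derivatives and Taylor remainders of the summand -/

/-- The `j`-th derivative in `y` of `y ^ s * (x * y ^ α + 1) ^ (-ν)`. Writing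
`x * y ^ α = (x * y ^ α + 1) - 1` after each differentiation keeps it a combination, with
coefficients independent of `x`, of `y ^ (s - j) * (x * y ^ α + 1) ^ (-ν - i)`, `i ≤ j`. -/
noncomputable def cutoffPow (α : ℝ) : ℕ → ℂ → ℝ → ℝ → ℝ → ℂ
  | 0, s, ν, x, y => (y : ℂ) ^ s * (((x * y ^ α + 1) ^ (-ν) : ℝ) : ℂ)
  | j + 1, s, ν, x, y => (s - α * ν) * cutoffPow α j (s - 1) ν x y +
      α * ν * cutoffPow α j (s - 1) (ν + 1) x y

/-- The binomial coefficient `binom (-ν) k`, i.e. the `k`-th Taylor coefficient of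
`(1 + u) ^ (-ν)` at `0`. -/
noncomputable def negBinomCoeff (ν : ℝ) (k : ℕ) : ℝ :=
  (-1) ^ k / (k.factorial : ℝ) * (Real.Gamma (ν + k) / Real.Gamma ν)

lemma negBinomCoeff_zero {ν : ℝ} (hν : 0 < ν) : negBinomCoeff ν 0 = 1 := by
  simp [negBinomCoeff, (Real.Gamma_pos_of_pos hν).ne']

lemma negBinomCoeff_succ {ν : ℝ} (hν : 0 < ν) (k : ℕ) :
    negBinomCoeff ν (k + 1) * (k + 1) = -ν * negBinomCoeff (ν + 1) k := by
  have h1 : Real.Gamma (ν + 1) = ν * Real.Gamma ν := Real.Gamma_add_one hν.ne'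
  have h2 := (Real.Gamma_pos_of_pos hν).ne'
  have h3 : (k.factorial : ℝ) ≠ 0 := by exact_mod_cast k.factorial_ne_zero
  have h4 : (k : ℝ) + 1 ≠ 0 := by positivity
  have h5 : ν + ((k + 1 : ℕ) : ℝ) = ν + 1 + k := by push_cast; ring
  simp only [negBinomCoeff, h1, h5, Nat.factorial_succ, Nat.cast_mul, pow_succ]
  push_cast
  field_simp

section

variable {α : ℝ}

lemma hasDerivAt_cutoffPow {x : ℝ} (hx : 0 ≤ x) {y : ℝ} (hy : 0 < y) (j : ℕ) (s : ℂ) (ν : ℝ) :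
    HasDerivAt (cutoffPow α j s ν x) (cutoffPow α (j + 1) s ν x y) y := by
  induction j generalizing s ν with
  | zero =>
    have hB : 0 < x * y ^ α + 1 := by positivity
    have h1 : HasDerivAt (fun t : ℝ => (t : ℂ) ^ s) (s * (y : ℂ) ^ (s - 1)) y := by
      have := (hasDerivAt_id (y : ℂ)).cpow_const (c := s) (Or.inl (by simpa using hy))
      simpa using this.comp_ofReal
    have h2 : HasDerivAt (fun t : ℝ => (x * t ^ α + 1) ^ (-ν))
        (x * (α * y ^ (α - 1)) * (-ν) * (x * y ^ α + 1) ^ (-ν - 1)) y :=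
      (((Real.hasDerivAt_rpow_const (Or.inl hy.ne')).const_mul x).add_const 1).rpow_const
        (Or.inl hB.ne')
    refine (h1.mul h2.ofReal_comp).congr_deriv ?_
    have e1 : (y : ℂ) ^ s = (y : ℂ) ^ (s - 1) * y := by
      have hy' : (y : ℂ) ≠ 0 := by exact_mod_cast hy.ne'
      rw [Complex.cpow_sub _ _ hy', Complex.cpow_one]
      field_simp
    have e2 : y ^ α = y ^ (α - 1) * y := by
      rw [Real.rpow_sub_one hy.ne']; field_simp
    have e3 : (x * y ^ α + 1) ^ (-ν) = (x * y ^ α + 1) ^ (-ν - 1) * (x * y ^ α + 1) := by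
      rw [Real.rpow_sub_one hB.ne']; field_simp
    have e4 : -(ν + 1) = -ν - 1 := by ring
    simp only [cutoffPow, e4]
    rw [e1, e3]
    generalize (x * y ^ α + 1) ^ (-ν - 1) = b
    rw [e2]
    push_cast
    ring
  | succ j ih =>
    exact ((ih (s - 1) ν).const_mul _).add ((ih (s - 1) (ν + 1)).const_mul _)

/-- Differentiation in `x` shifts `(s, ν)` to `(s + α, ν + 1)`. -/
lemma hasDerivAt_cutoffPow_param {x : ℝ} (hx : 0 ≤ x) {y : ℝ} (hy : 0 < y) (j : ℕ) (s : ℂ)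
    (ν : ℝ) : HasDerivAt (fun x => cutoffPow α j s ν x y)
      (-ν * cutoffPow α j (s + α) (ν + 1) x y) x := by
  induction j generalizing s ν with
  | zero =>
    have hB : 0 < x * y ^ α + 1 := by positivity
    have h2 : HasDerivAt (fun x : ℝ => (x * y ^ α + 1) ^ (-ν))
        (y ^ α * (-ν) * (x * y ^ α + 1) ^ (-ν - 1)) x := by
      simpa using (((hasDerivAt_id x).mul_const (y ^ α)).add_const 1).rpow_const
        (p := -ν) (Or.inl hB.ne')
    refine (h2.ofReal_comp.const_mul ((y : ℂ) ^ s)).congr_deriv ?_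
    have e4 : -(ν + 1) = -ν - 1 := by ring
    simp only [cutoffPow, e4]
    rw [Complex.cpow_add _ _ (by exact_mod_cast hy.ne'), ← Complex.ofReal_cpow hy.le]
    push_cast
    ring
  | succ j ih =>
    refine (((ih (s - 1) ν).const_mul _).add ((ih (s - 1) (ν + 1)).const_mul _)).congr_deriv ?_
    simp only [cutoffPow]
    rw [show s - 1 + (α : ℂ) = s + α - 1 by ring]
    push_cast
    ring

/-- Without cutoff (`x = 0`) the exponent `ν` plays no role. -/
lemma cutoffPow_zero_param (j : ℕ) (s : ℂ) (ν y : ℝ) :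
    cutoffPow α j s ν 0 y = cutoffPow α j s 0 0 y := by
  induction j generalizing s ν with
  | zero => simp [cutoffPow]
  | succ j ih =>
    simp only [cutoffPow]
    rw [ih _ ν, ih _ (ν + 1), ih _ (0 + 1)]
    push_cast
    ring

/-- The constant is uniform in `x ≥ 0` and in the exponent on bounded sets. -/
lemma exists_norm_cutoffPow_le (j : ℕ) (R : ℝ) {ν : ℝ} (hν : 0 ≤ ν) :
    ∃ C : ℝ, 0 ≤ C ∧ ∀ s : ℂ, ‖s‖ ≤ R → ∀ x : ℝ, 0 ≤ x → ∀ y : ℝ, 0 < y →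
      ‖cutoffPow α j s ν x y‖ ≤ C * (y ^ (s.re - j) * (x * y ^ α + 1) ^ (-ν)) := by
  induction j generalizing R ν with
  | zero =>
    refine ⟨1, zero_le_one, fun s _ x hx y hy => ?_⟩
    have hB : 0 < x * y ^ α + 1 := by positivity
    simp only [cutoffPow, norm_mul, Complex.norm_cpow_eq_rpow_re_of_pos hy, Complex.norm_real,
      Real.norm_of_nonneg (Real.rpow_nonneg hB.le _), Nat.cast_zero, sub_zero, one_mul, le_refl]
  | succ j ih =>
    obtain ⟨C₁, h₁, H₁⟩ := ih (R + 1) hν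
    obtain ⟨C₂, h₂, H₂⟩ := ih (R + 1) (by linarith : 0 ≤ ν + 1)
    refine ⟨(|R| + |α| * ν) * C₁ + |α| * ν * C₂, by positivity, fun s hs x hx y hy => ?_⟩
    have hs1 : ‖s - 1‖ ≤ R + 1 := (norm_sub_le _ _).trans (by simpa using hs)
    have hB : 1 ≤ x * y ^ α + 1 := by
      have : 0 ≤ x * y ^ α := by positivity
      linarith
    have e : (s - 1).re - j = s.re - (j + 1 : ℕ) := by push_cast; simp; ring
    have b₁ := H₁ (s - 1) hs1 x hx y hy
    have b₂ := (H₂ (s - 1) hs1 x hx y hy).trans (mul_le_mul_of_nonneg_left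
      (mul_le_mul_of_nonneg_left (Real.rpow_le_rpow_of_exponent_le hB
        (by linarith : -(ν + 1) ≤ -ν)) (by positivity)) h₂)
    rw [e] at b₁ b₂
    have hsR : ‖s - α * ν‖ ≤ |R| + |α| * ν := by
      refine (norm_sub_le _ _).trans (add_le_add (hs.trans (le_abs_self R)) ?_)
      simp [abs_of_nonneg hν]
    have hα : ‖(α : ℂ) * ν‖ ≤ |α| * ν := by simp [abs_of_nonneg hν]
    simp only [cutoffPow]
    refine (norm_add_le _ _).trans ?_
    rw [norm_mul, norm_mul (_ * _), add_mul, mul_assoc (_ + _), mul_assoc (|α| * ν)]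
    gcongr

/-- The `j`-th derivative in `y` of the `N`-th Taylor remainder in `x` of
`y ^ s * (x * y ^ α + 1) ^ (-ν)`. -/
noncomputable def cutoffPowRem (α : ℝ) (N j : ℕ) (s : ℂ) (ν x y : ℝ) : ℂ :=
  cutoffPow α j s ν x y -
    ∑ k ∈ Finset.range N, (negBinomCoeff ν k : ℂ) * (x : ℂ) ^ k * cutoffPow α j (s + α * k) 0 0 y

lemma hasDerivAt_cutoffPowRem {ν : ℝ} (hν : 0 < ν) {x : ℝ} (hx : 0 ≤ x) {y : ℝ} (hy : 0 < y)
    (N j : ℕ) (s : ℂ) : HasDerivAt (fun x => cutoffPowRem α (N + 1) j s ν x y)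
      (-ν * cutoffPowRem α N j (s + α) (ν + 1) x y) x := by
  unfold cutoffPowRem
  simp only [Finset.sum_range_succ' _ N]
  have hk (k : ℕ) : HasDerivAt (fun x : ℝ => (negBinomCoeff ν (k + 1) : ℂ) * (x : ℂ) ^ (k + 1) *
      cutoffPow α j (s + α * ((k + 1 : ℕ) : ℂ)) 0 0 y)
      (-ν * ((negBinomCoeff (ν + 1) k : ℂ) * (x : ℂ) ^ k *
        cutoffPow α j (s + α + α * k) 0 0 y)) x := by
    have h1 : HasDerivAt (fun x : ℝ => (x : ℂ) ^ (k + 1)) (((k + 1 : ℕ) : ℂ) * (x : ℂ) ^ k) x := by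
      simpa using (hasDerivAt_pow (k + 1) (x : ℂ)).comp_ofReal
    refine ((h1.const_mul (negBinomCoeff ν (k + 1) : ℂ)).mul_const _).congr_deriv ?_
    have h2 : (negBinomCoeff ν (k + 1) : ℂ) * (k + 1) = -ν * negBinomCoeff (ν + 1) k := by
      exact_mod_cast negBinomCoeff_succ hν k
    have h3 : s + α * ((k + 1 : ℕ) : ℂ) = s + α + α * k := by push_cast; ring
    rw [h3]
    push_cast
    linear_combination (x : ℂ) ^ k * cutoffPow α j (s + α + α * k) 0 0 y * h2
  have h := (hasDerivAt_cutoffPow_param (α := α) hx hy j s ν).sub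
    ((HasDerivAt.fun_sum fun k (_ : k ∈ Finset.range N) => hk k).add_const
      ((negBinomCoeff ν 0 : ℂ) * ((x : ℂ) ^ 0 * cutoffPow α j (s + α * (0 : ℕ)) 0 0 y)))
  refine HasDerivAt.congr_deriv (h.congr_of_eventuallyEq (Eventually.of_forall fun t => ?_)) ?_
  · simp [mul_assoc]
  · rw [← Finset.mul_sum]; ring

/-- The Taylor remainder in `x` is `O(x ^ N)` with the expected growth in `y`; this follows by
integrating the `x`-derivative, which is a remainder of order `N - 1` with shifted parameters. -/
lemma exists_norm_cutoffPowRem_le (N j : ℕ) (s : ℂ) {ν : ℝ} (hν : 0 < ν) :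
    ∃ C : ℝ, 0 ≤ C ∧ ∀ x : ℝ, 0 ≤ x → ∀ y : ℝ, 0 < y →
      ‖cutoffPowRem α N j s ν x y‖ ≤ C * x ^ N * y ^ (s.re + α * N - j) := by
  induction N generalizing s ν with
  | zero =>
    obtain ⟨C, hC, H⟩ := exists_norm_cutoffPow_le (α := α) j ‖s‖ hν.le
    refine ⟨C, hC, fun x hx y hy => ?_⟩
    have hB : 1 ≤ x * y ^ α + 1 := by
      have : 0 ≤ x * y ^ α := by positivity
      linarith
    simp only [cutoffPowRem, Finset.range_zero, Finset.sum_empty, sub_zero, pow_zero, mul_one,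
      Nat.cast_zero, mul_zero, add_zero]
    refine (H s le_rfl x hx y hy).trans (mul_le_mul_of_nonneg_left ?_ hC)
    exact mul_le_of_le_one_right (by positivity)
      (Real.rpow_le_one_of_one_le_of_nonpos hB (by linarith))
  | succ N ih =>
    obtain ⟨C, hC, H⟩ := ih (s + α) (by linarith : 0 < ν + 1)
    refine ⟨ν * C, by positivity, fun x hx y hy => ?_⟩
    have e : (s + α).re + α * N - j = s.re + α * (N + 1 : ℕ) - j := by push_cast; simp; ring
    have hder : ∀ t ∈ Set.Icc 0 x, HasDerivWithinAt (fun x => cutoffPowRem α (N + 1) j s ν x y)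
        (-ν * cutoffPowRem α N j (s + α) (ν + 1) t y) (Set.Icc 0 x) t :=
      fun t ht => (hasDerivAt_cutoffPowRem hν ht.1 hy N j s).hasDerivWithinAt
    have hbd : ∀ t ∈ Set.Icc 0 x, ‖-ν * cutoffPowRem α N j (s + α) (ν + 1) t y‖ ≤
        ν * (C * x ^ N * y ^ (s.re + α * (N + 1 : ℕ) - j)) := by
      intro t ht
      rw [norm_mul, norm_neg, Complex.norm_real, Real.norm_of_nonneg hν.le, ← e]
      refine mul_le_mul_of_nonneg_left ((H t ht.1 y hy).trans ?_) hν.le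
      have := ht.1
      have := ht.2
      gcongr
    have h := (convex_Icc 0 x).norm_image_sub_le_of_norm_hasDerivWithin_le hder hbd
      (Set.left_mem_Icc.mpr hx) (Set.right_mem_Icc.mpr hx)
    have h0 : cutoffPowRem α (N + 1) j s ν 0 y = 0 := by
      simp only [cutoffPowRem, Finset.sum_range_succ']
      simp [cutoffPow_zero_param j s ν y, negBinomCoeff_zero hν]
    rw [h0, sub_zero, sub_zero, Real.norm_of_nonneg hx] at h
    exact h.trans (le_of_eq (by ring))

end

/-! ### Euler–Maclaurin constants of powers -/

section

variable {α : ℝ}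

lemma exists_norm_cutoffPow_zero_le (j : ℕ) (R : ℝ) :
    ∃ C : ℝ, 0 ≤ C ∧ ∀ s : ℂ, ‖s‖ ≤ R → ∀ y : ℝ, 0 < y →
      ‖cutoffPow α j s 0 0 y‖ ≤ C * y ^ (s.re - j) := by
  obtain ⟨C, hC, H⟩ := exists_norm_cutoffPow_le (α := α) j R le_rfl
  exact ⟨C, hC, fun s hs y hy => by simpa using H s hs 0 le_rfl y hy⟩

lemma tendsto_cutoffPow_zero_atTop {j : ℕ} {s : ℂ} (hs : s.re < j) :
    Tendsto (cutoffPow α j s 0 0) atTop (𝓝 0) := by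
  obtain ⟨C, -, H⟩ := exists_norm_cutoffPow_zero_le (α := α) j ‖s‖
  refine squeeze_zero_norm' (a := fun y => C * y ^ (s.re - j)) ?_ ?_
  · filter_upwards [eventually_gt_atTop 0] with y hy using H s le_rfl y hy
  · have h := tendsto_rpow_neg_atTop (by linarith : 0 < j - s.re)
    simpa using h.const_mul C

/-- The Euler–Maclaurin formula for `∑ (k + a) ^ s`, `Re s < 0`. -/
lemma tendsto_sum_pow_sub_integral {M : ℕ} (hM : M ≠ 0) {a : ℝ} (ha : 0 < a) {s : ℂ}
    (hs : s.re < 0) :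
    Tendsto (fun K : ℕ => ∑ k ∈ Finset.range K, (((k : ℝ) + a : ℝ) : ℂ) ^ s -
      ∫ t in a..K + a, (t : ℂ) ^ s) atTop (𝓝 (emConst M (fun j => cutoffPow α j s 0 0) a)) := by
  obtain ⟨D, hD, H⟩ := exists_norm_cutoffPow_zero_le (α := α) M ‖s‖
  have hM1 : (1 : ℝ) ≤ M := by exact_mod_cast Nat.one_le_iff_ne_zero.mpr hM
  have h := tendsto_sum_sub_integral_emConst (F := fun j => cutoffPow α j s 0 0) ha hM
    (fun j t ht => hasDerivAt_cutoffPow le_rfl ht j s 0)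
    (fun j _ => tendsto_cutoffPow_zero_atTop (hs.trans_le j.cast_nonneg)) hD
    (by linarith : s.re - M < -1) (fun y hy => H s le_rfl y hy)
  simpa [cutoffPow] using h

lemma integral_cpow_Icc {s : ℂ} (hs : s ≠ -1) {u v : ℝ} (hu : 0 < u) (hv : 0 < v) :
    ∫ t in u..v, (t : ℂ) ^ s = ((v : ℂ) ^ (s + 1) - (u : ℂ) ^ (s + 1)) / (s + 1) :=
  integral_cpow (Or.inr ⟨hs, fun h => by
    have := h.1
    rw [inf_le_iff] at this
    rcases this with h | h <;> linarith⟩)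

/-- For `Re s < -1` series and integral converge separately. -/
lemma emConst_pow_of_re_lt {M : ℕ} (hM : M ≠ 0) {a : ℝ} (ha : 0 < a) {s : ℂ} (hs : s.re < -1) :
    emConst M (fun j => cutoffPow α j s 0 0) a =
      hurwitzZetaPos (-s) a + (a : ℂ) ^ (s + 1) / (s + 1) := by
  have hs1 : s ≠ -1 := by rintro rfl; simp at hs
  refine tendsto_nhds_unique (tendsto_sum_pow_sub_integral hM ha (by linarith)) ?_
  have h1 := (hasSum_hurwitzZetaPos ha (s := -s) (by simpa using by linarith)).tendsto_sum_nat
  have h2 : Tendsto (fun K : ℕ => (((K : ℝ) + a : ℝ) : ℂ) ^ (s + 1)) atTop (𝓝 0) := by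
    have h3 : (s + 1).re < (0 : ℕ) := by simp; linarith
    have h4 := (tendsto_cutoffPow_zero_atTop (α := α) h3).comp
      (tendsto_atTop_add_const_right atTop a tendsto_natCast_atTop_atTop)
    simpa [cutoffPow, Function.comp_def] using h4
  have h5 := h1.sub ((h2.sub_const ((a : ℂ) ^ (s + 1))).div_const (s + 1))
  rw [zero_sub, neg_div, sub_neg_eq_add] at h5
  refine h5.congr fun K => ?_
  rw [integral_cpow_Icc hs1 ha (by positivity)]
  congr 1
  exact Finset.sum_congr rfl fun k _ => by simp [Complex.cpow_neg]

lemma differentiable_cutoffPow_exponent (j : ℕ) {ν x y : ℝ} (hy : 0 < y) :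
    Differentiable ℂ fun s => cutoffPow α j s ν x y := by
  have hy' : (y : ℂ) ≠ 0 := by exact_mod_cast hy.ne'
  induction j generalizing ν with
  | zero =>
    intro s
    exact (differentiableAt_id.const_cpow (Or.inl hy')).mul_const _
  | succ j ih =>
    have h (ν : ℝ) : Differentiable ℂ fun s => cutoffPow α j (s - 1) ν x y :=
      (ih (ν := ν)).comp (differentiable_id.sub_const 1)
    exact ((differentiable_id.sub_const _).mul (h ν)).add ((h (ν + 1)).const_mul _)

/-- The remainder is analytic in the exponent because the Euler–Maclaurin formula on `[y, y + 1]`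
expresses it in closed form. -/
lemma differentiableAt_emRem_cutoffPow {M : ℕ} (hM : M ≠ 0) {y : ℝ} (hy : 0 < y) {s : ℂ}
    (hs : s ≠ -1) : DifferentiableAt ℂ (fun s => emRem M (cutoffPow α M s 0 0) y) s := by
  obtain ⟨M, rfl⟩ := Nat.exists_eq_succ_of_ne_zero hM
  have hy1 : 0 < y + 1 := by linarith
  have hc {z : ℝ} (hz : 0 < z) (j : ℕ) :
      DifferentiableAt ℂ (fun s => cutoffPow α j s 0 0 z) s :=
    differentiable_cutoffPow_exponent j hz s
  have hd {z : ℝ} (hz : 0 < z) : DifferentiableAt ℂ (fun s => (z : ℂ) ^ (s + 1)) s :=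
    (differentiableAt_id.add_const 1).const_cpow (Or.inl (by exact_mod_cast hz.ne'))
  have key : (fun s => emRem (M + 1) (cutoffPow α (M + 1) s 0 0) y) =ᶠ[𝓝 s] fun s =>
      cutoffPow α 0 s 0 0 y - (((y + 1 : ℝ) : ℂ) ^ (s + 1) - (y : ℂ) ^ (s + 1)) / (s + 1) -
      ∑ j ∈ Finset.range (M + 1),
        emCoeff j * (cutoffPow α j s 0 0 (y + 1) - cutoffPow α j s 0 0 y) := by
    filter_upwards [isOpen_ne.mem_nhds hs] with z hz
    have h := eq_integral_add_emRem M (F := fun j => cutoffPow α j z 0 0) (y := y)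
      fun j t ht => hasDerivAt_cutoffPow le_rfl (hy.trans_le ht.1) j z 0
    rw [← integral_cpow_Icc hz hy hy1]
    have e : ∫ t in y..y + 1, cutoffPow α 0 z 0 0 t = ∫ t in y..y + 1, (t : ℂ) ^ z := by
      simp [cutoffPow]
    rw [← e]
    linear_combination -h
  refine DifferentiableAt.congr_of_eventuallyEq ?_ key
  refine ((hc hy 0).sub (((hd hy1).sub (hd hy)).div (differentiableAt_id.add_const 1) ?_)).sub
    (DifferentiableAt.fun_sum fun j _ => ((hc hy1 j).sub (hc hy j)).const_mul _)
  simpa [add_eq_zero_iff_eq_neg] using hs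

lemma rpow_le_rpow_add_rpow {y p q r : ℝ} (hy : 0 < y) (hpq : p ≤ q) (hqr : q ≤ r) :
    y ^ q ≤ y ^ p + y ^ r := by
  rcases le_total y 1 with h | h
  · have := Real.rpow_le_rpow_of_exponent_ge hy h hpq
    have : 0 < y ^ r := by positivity
    linarith
  · have := Real.rpow_le_rpow_of_exponent_le h hqr
    have : 0 < y ^ p := by positivity
    linarith

lemma differentiableOn_emConst_pow {M : ℕ} (hM : M ≠ 0) {a : ℝ} (ha : 0 < a) {R q : ℝ}
    (hR : 0 < R) (hq : q - M < -1) :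
    DifferentiableOn ℂ (fun s => emConst M (fun j => cutoffPow α j s 0 0) a)
      {s | ‖s‖ < R ∧ s.re < q ∧ s ≠ -1} := by
  have hopen : IsOpen {s : ℂ | ‖s‖ < R ∧ s.re < q ∧ s ≠ -1} :=
    (isOpen_lt continuous_norm continuous_const).inter
      ((isOpen_lt Complex.continuous_re continuous_const).inter isOpen_ne)
  have hM1 : (1 : ℝ) ≤ M := by exact_mod_cast Nat.one_le_iff_ne_zero.mpr hM
  obtain ⟨C, hC, hCb⟩ := exists_norm_emRem_le M
  obtain ⟨D, hD, H⟩ := exists_norm_cutoffPow_zero_le (α := α) M R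
  unfold emConst
  refine DifferentiableOn.add ?_ ?_
  · refine DifferentiableOn.neg (DifferentiableOn.fun_sum fun j _ => ?_)
    exact ((differentiable_cutoffPow_exponent j ha).differentiableOn).const_mul _
  -- `-R < Re s < q`, and both endpoints are used since `k + a` may be less than `1`
  · refine Complex.differentiableOn_tsum_of_summable_norm
      (u := fun k : ℕ => C * D * (((k : ℝ) + a) ^ (-R - M) + ((k : ℝ) + a) ^ (q - M)))
      (((summable_add_rpow ha (by linarith)).add (summable_add_rpow ha hq)).mul_left _)
      (fun k s hs => (differentiableAt_emRem_cutoffPow hM (by positivity)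
        hs.2.2).differentiableWithinAt) hopen fun k s hs => ?_
    have hre : -R < s.re := by
      have := (abs_le.mp (Complex.abs_re_le_norm s)).1
      linarith [hs.1]
    have h := norm_emRem_le_of_rpow hCb hD (by linarith [hs.2.1] : s.re - M ≤ 0)
      (H s hs.1.le) (y := k + a) (by positivity)
    refine h.trans (mul_le_mul_of_nonneg_left ?_ (by positivity))
    exact rpow_le_rpow_add_rpow (by positivity) (by linarith) (by linarith [hs.2.1])

/-- The Euler–Maclaurin constant of `y ^ σ` is the Hurwitz zeta value `ζ(-σ, a)`, up to the
finite part of `∫_a^∞ y ^ σ`. For `σ ≥ -1` this is analytic continuation in the exponent; the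
identity theorem is applied in the upper half plane, where the domain is convex. -/
lemma emConst_pow {M : ℕ} {a : ℝ} (ha : 0 < a) {σ : ℝ} (hσ : σ ≠ -1) (hM : σ < M - 1)
    (hM0 : M ≠ 0) : emConst M (fun j => cutoffPow α j σ 0 0) a =
      hurwitzZetaPos (-σ) a + (a : ℂ) ^ ((σ : ℂ) + 1) / (σ + 1) := by
  obtain ⟨q, hq₁, hq₂⟩ := exists_between hM
  set R : ℝ := |σ| + 4
  have hR : 0 < R := by positivity
  have hM1 : (1 : ℝ) ≤ M := by exact_mod_cast Nat.one_le_iff_ne_zero.mpr hM0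
  set f : ℂ → ℂ := fun s => emConst M (fun j => cutoffPow α j s 0 0) a
  set g : ℂ → ℂ := fun s => hurwitzZetaPos (-s) a + (a : ℂ) ^ (s + 1) / (s + 1)
  have ha' : (a : ℂ) ≠ 0 := by exact_mod_cast ha.ne'
  have hg (s : ℂ) (hs : s ≠ -1) : DifferentiableAt ℂ g s := by
    refine DifferentiableAt.add ?_ (((differentiableAt_id.add_const 1).const_cpow
      (Or.inl ha')).div (differentiableAt_id.add_const 1) ?_)
    · exact (differentiableAt_hurwitzZetaPos ha (s := -s) (by
        rwa [ne_eq, neg_eq_iff_eq_neg])).comp s differentiableAt_id.neg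
    · simpa [add_eq_zero_iff_eq_neg] using hs
  obtain ⟨Q, hQ₁, hQ₂, hQ₃⟩ : ∃ Q : ℝ, σ < Q ∧ -2 < Q ∧ Q - M < -1 := by
    refine ⟨max q (-3 / 2), lt_max_of_lt_left hq₁, lt_max_of_lt_right (by norm_num), ?_⟩
    rcases max_cases q (-3 / 2) with h | h <;> rw [h.1] <;> linarith
  have hf := differentiableOn_emConst_pow (α := α) hM0 ha hR hQ₃
  have hUopen : IsOpen {s : ℂ | ‖s‖ < R ∧ s.re < Q ∧ s ≠ -1} :=
    (isOpen_lt continuous_norm continuous_const).inter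
      ((isOpen_lt Complex.continuous_re continuous_const).inter isOpen_ne)
  set V : Set ℂ := Metric.ball 0 R ∩ ({s | s.re < Q} ∩ {s | 0 < s.im})
  have hVne : ∀ s ∈ V, s ≠ -1 := by
    rintro s hs rfl
    simpa using hs.2.2
  have hVU : V ⊆ {s : ℂ | ‖s‖ < R ∧ s.re < Q ∧ s ≠ -1} := fun s hs =>
    ⟨by simpa using hs.1, hs.2.1, hVne s hs⟩
  have hVopen : IsOpen V := Metric.isOpen_ball.inter
    ((isOpen_lt Complex.continuous_re continuous_const).inter
      (isOpen_lt continuous_const Complex.continuous_im))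
  have hVconv : Convex ℝ V := (convex_ball 0 R).inter
    ((convex_halfSpace_re_lt Q).inter (convex_halfSpace_im_gt 0))
  have hz : (⟨-2, 1⟩ : ℂ) ∈ V := by
    refine ⟨?_, hQ₂, by simp⟩
    rw [mem_ball_zero_iff]
    refine (Complex.norm_le_abs_re_add_abs_im _).trans_lt ?_
    have := abs_nonneg σ
    norm_num [R]
    linarith
  have hgV : DifferentiableOn ℂ g V := fun s hs => (hg s (hVne s hs)).differentiableWithinAt
  have hEq : Set.EqOn f g V := by
    refine ((hf.mono hVU).analyticOnNhd hVopen).eqOn_of_preconnected_of_eventuallyEq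
      (hgV.analyticOnNhd hVopen) hVconv.isPreconnected hz ?_
    filter_upwards [(isOpen_lt Complex.continuous_re (continuous_const (y := (-1 : ℝ)))).mem_nhds
      (by simp : (⟨-2, 1⟩ : ℂ).re < -1)] with s hs using emConst_pow_of_re_lt hM0 ha hs
  have hσ' : (σ : ℂ) ≠ -1 := by exact_mod_cast hσ
  have hfc : ContinuousAt f σ := (hf.differentiableAt (hUopen.mem_nhds
    ⟨by simp [R], by simpa using hQ₁, hσ'⟩)).continuousAt
  have hpath : Tendsto (fun t : ℝ => (σ : ℂ) + t * Complex.I) (𝓝[>] 0) (𝓝 σ) := by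
    have : Continuous fun t : ℝ => (σ : ℂ) + t * Complex.I := by fun_prop
    simpa using (this.tendsto 0).mono_left nhdsWithin_le_nhds
  -- the equality extends from the upper half plane to the real point `σ` by continuity
  refine tendsto_nhds_unique (hfc.tendsto.comp hpath)
    (((hg σ hσ').continuousAt.tendsto.comp hpath).congr' ?_)
  have hball : ∀ᶠ t : ℝ in 𝓝[>] 0, (σ : ℂ) + t * Complex.I ∈ Metric.ball (0 : ℂ) R :=
    hpath.eventually (Metric.isOpen_ball.mem_nhds (by simp [R]))
  filter_upwards [hball, self_mem_nhdsWithin] with t ht₁ ht₂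
  exact (hEq ⟨ht₁, by simpa using hQ₁, by simpa using ht₂⟩).symm

end

lemma hasDerivAt_Gamma_of_pos {y : ℝ} (hy : 0 < y) :
    HasDerivAt Real.Gamma (deriv Real.Gamma y) y :=
  (Real.differentiableAt_Gamma fun m => by
    have : (0 : ℝ) ≤ m := m.cast_nonneg
    linarith).hasDerivAt

/-- The digamma function is asymptotic to the logarithm, by convexity of `log Γ`. -/
lemma tendsto_digamma_sub_log :
    Tendsto (fun y : ℝ => deriv Real.Gamma y / Real.Gamma y - Real.log y) atTop (𝓝 0) := by
  have hlog {y : ℝ} (hy : 0 < y) : HasDerivAt (Real.log ∘ Real.Gamma)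
      (deriv Real.Gamma y / Real.Gamma y) y :=
    (hasDerivAt_Gamma_of_pos hy).log (Real.Gamma_pos_of_pos hy).ne'
  have hstep {y : ℝ} (hy : 0 < y) :
      (Real.log ∘ Real.Gamma) (y + 1) = Real.log y + (Real.log ∘ Real.Gamma) y := by
    simp only [Function.comp, Real.Gamma_add_one hy.ne']
    exact Real.log_mul hy.ne' (Real.Gamma_pos_of_pos hy).ne'
  have hup {y : ℝ} (hy : 0 < y) : deriv Real.Gamma y / Real.Gamma y ≤ Real.log y := by
    have h := Real.convexOn_log_Gamma.le_slope_of_hasDerivAt (x := y) (y := y + 1) hy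
      (by simpa using by linarith) (by linarith) (hlog hy)
    rw [slope_def_field, hstep hy] at h
    simpa using h
  have hlow {y : ℝ} (hy : 0 < y) : Real.log y ≤ deriv Real.Gamma (y + 1) / Real.Gamma (y + 1) := by
    have h := Real.convexOn_log_Gamma.slope_le_of_hasDerivAt (x := y) (y := y + 1) hy
      (by simpa using by linarith) (by linarith) (hlog (by linarith))
    rw [slope_def_field, hstep hy] at h
    simpa using h
  have hlim : Tendsto (fun y : ℝ => Real.log (1 - y⁻¹)) atTop (𝓝 0) := by
    have h : Tendsto (fun y : ℝ => 1 - y⁻¹) atTop (𝓝 1) := by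
      simpa using tendsto_inv_atTop_zero.const_sub (1 : ℝ)
    simpa [Function.comp_def] using (Real.continuousAt_log one_ne_zero).tendsto.comp h
  refine tendsto_of_tendsto_of_tendsto_of_le_of_le' hlim tendsto_const_nhds ?_ ?_
  · filter_upwards [eventually_gt_atTop 1] with y hy
    have hy0 : 0 < y := by linarith
    have h := hlow (y := y - 1) (by linarith)
    rw [sub_add_cancel] at h
    have e : 1 - y⁻¹ = (y - 1) / y := by field_simp
    rw [e, Real.log_div (by linarith) hy0.ne']
    linarith
  · filter_upwards [eventually_gt_atTop 0] with y hy
    linarith [hup hy]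

lemma digamma_add_one {y : ℝ} (hy : 0 < y) :
    deriv Real.Gamma (y + 1) / Real.Gamma (y + 1) = deriv Real.Gamma y / Real.Gamma y + 1 / y := by
  have hG := (Real.Gamma_pos_of_pos hy).ne'
  have h1 : HasDerivAt (fun t => t * Real.Gamma t) (1 * Real.Gamma y + y * deriv Real.Gamma y) y :=
    (hasDerivAt_id y).mul (hasDerivAt_Gamma_of_pos hy)
  have h2 : deriv Real.Gamma (y + 1) = 1 * Real.Gamma y + y * deriv Real.Gamma y := by
    rw [← deriv_comp_add_const]
    refine (h1.congr_of_eventuallyEq ?_).deriv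
    filter_upwards [lt_mem_nhds hy] with t ht using Real.Gamma_add_one ht.ne'
  rw [h2, Real.Gamma_add_one hy.ne']
  field_simp
  ring

/-- In the exceptional case `σ = -1` the Euler–Maclaurin constant is `log a - ψ(a)`. -/
lemma emConst_inv {α : ℝ} {M : ℕ} (hM : M ≠ 0) {a : ℝ} (ha : 0 < a) :
    emConst M (fun j => cutoffPow α j (-1) 0 0) a =
      ((Real.log a - deriv Real.Gamma a / Real.Gamma a : ℝ) : ℂ) := by
  refine tendsto_nhds_unique (tendsto_sum_pow_sub_integral hM ha (by simp)) ?_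
  have hsum (K : ℕ) : ∑ k ∈ Finset.range K, 1 / ((k : ℝ) + a) =
      deriv Real.Gamma (K + a) / Real.Gamma (K + a) - deriv Real.Gamma a / Real.Gamma a := by
    induction K with
    | zero => simp
    | succ K ih =>
      have h := digamma_add_one (y := K + a) (by positivity)
      have e : ((K + 1 : ℕ) : ℝ) + a = K + a + 1 := by push_cast; ring
      rw [Finset.sum_range_succ, ih, e, h]
      ring
  have h1 := (tendsto_digamma_sub_log.comp (tendsto_atTop_add_const_right atTop a
    tendsto_natCast_atTop_atTop)).add_const (Real.log a - deriv Real.Gamma a / Real.Gamma a)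
  rw [zero_add] at h1
  refine ((Complex.continuous_ofReal.tendsto _).comp h1).congr fun K => ?_
  have hK : 0 < (K : ℝ) + a := by positivity
  have hint : ∫ t in a..K + a, (t : ℂ) ^ (-1 : ℂ) = ((Real.log (K + a) - Real.log a : ℝ) : ℂ) := by
    have h2 : ∫ t in a..K + a, t⁻¹ = Real.log ((K + a) / a) := integral_inv_of_pos ha hK
    rw [← Real.log_div hK.ne' ha.ne', ← h2, ← intervalIntegral.integral_ofReal]
    exact intervalIntegral.integral_congr fun t _ => by simp [Complex.cpow_neg_one]
  have hs : ∑ k ∈ Finset.range K, (((k : ℝ) + a : ℝ) : ℂ) ^ (-1 : ℂ) =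
      ((∑ k ∈ Finset.range K, 1 / ((k : ℝ) + a) : ℝ) : ℂ) := by
    push_cast
    exact Finset.sum_congr rfl fun k _ => by simp [Complex.cpow_neg_one]
  rw [hint, hs, hsum]
  simp only [Function.comp]
  push_cast
  ring

/-! ### The difference of the series and the integral -/

lemma emRem_sub_sum {M N : ℕ} {f : ℝ → ℂ} {g : ℕ → ℝ → ℂ} (c : ℕ → ℂ)
    (hf : ContinuousOn f (Set.Ioi 0)) (hg : ∀ k < N, ContinuousOn (g k) (Set.Ioi 0)) {y : ℝ}
    (hy : 0 < y) : emRem M (fun t => f t - ∑ k ∈ Finset.range N, c k * g k t) y =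
      emRem M f y - ∑ k ∈ Finset.range N, c k * emRem M (g k) y := by
  have hb : Continuous fun t : ℝ => (bernoulliFun M t : ℂ) :=
    Complex.continuous_ofReal.comp (continuous_bernoulliFun M)
  have hint {h : ℝ → ℂ} (hh : ContinuousOn h (Set.Ioi 0)) : IntervalIntegrable
      (fun t => (bernoulliFun M t : ℂ) * h (y + t)) MeasureTheory.volume 0 1 := by
    refine ContinuousOn.intervalIntegrable
      (hb.continuousOn.mul (hh.comp (by fun_prop) fun t ht => ?_))
    rw [Set.uIcc_of_le zero_le_one] at ht
    simp only [Set.mem_Ioi]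
    linarith [ht.1]
  have e : (fun t : ℝ => (bernoulliFun M t : ℂ) *
      (f (y + t) - ∑ k ∈ Finset.range N, c k * g k (y + t))) = fun t =>
      (bernoulliFun M t : ℂ) * f (y + t) -
        ∑ k ∈ Finset.range N, c k * ((bernoulliFun M t : ℂ) * g k (y + t)) := by
    ext t
    rw [mul_sub, Finset.mul_sum]
    congr 1
    exact Finset.sum_congr rfl fun k _ => by ring
  have hgi (k : ℕ) (hk : k ∈ Finset.range N) :=
    (hint (hg k (Finset.mem_range.mp hk))).const_mul (c k)
  have hgs : IntervalIntegrable (fun t => ∑ k ∈ Finset.range N,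
      c k * ((bernoulliFun M t : ℂ) * g k (y + t))) MeasureTheory.volume 0 1 := by
    simpa [Finset.sum_fn] using IntervalIntegrable.sum (Finset.range N) hgi
  simp only [emRem]
  rw [e, intervalIntegral.integral_sub (hint hf) hgs,
    intervalIntegral.integral_finsetSum hgi, mul_sub, Finset.mul_sum]
  congr 1
  refine Finset.sum_congr rfl fun k _ => ?_
  rw [intervalIntegral.integral_const_mul]
  ring

lemma emConst_sub_sum {M N : ℕ} {F : ℕ → ℝ → ℂ} {G : ℕ → ℕ → ℝ → ℂ} (c : ℕ → ℂ) {a : ℝ}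
    (ha : 0 < a) (hF : ContinuousOn (F M) (Set.Ioi 0))
    (hG : ∀ k < N, ContinuousOn (G k M) (Set.Ioi 0))
    (hFs : Summable fun n : ℕ => emRem M (F M) (n + a))
    (hGs : ∀ k < N, Summable fun n : ℕ => emRem M (G k M) (n + a)) :
    emConst M F a - ∑ k ∈ Finset.range N, c k * emConst M (G k) a =
      emConst M (fun j t => F j t - ∑ k ∈ Finset.range N, c k * G k j t) a := by
  have h1 (n : ℕ) := emRem_sub_sum (M := M) c hF hG (y := n + a) (by positivity)
  have hGs' : ∀ k ∈ Finset.range N, Summable fun n : ℕ => c k * emRem M (G k M) (n + a) :=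
    fun k hk => (hGs k (Finset.mem_range.mp hk)).mul_left _
  simp only [emConst, h1]
  rw [hFs.tsum_sub (summable_sum hGs'), Summable.tsum_finsetSum hGs']
  simp only [mul_add, mul_sub, Finset.sum_add_distrib, Finset.sum_sub_distrib, tsum_mul_left,
    Finset.mul_sum, mul_neg, Finset.sum_neg_distrib]
  rw [Finset.sum_comm (s := Finset.range N)]
  simp only [mul_left_comm]
  ring

lemma div_rpow_eq_mul_rpow_neg {x y γ α μ : ℝ} (hx : 0 ≤ x) (hy : 0 < y) :
    y ^ γ / (x * y ^ α + 1) ^ μ = y ^ γ * (x * y ^ α + 1) ^ (-μ) := by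
  rw [Real.rpow_neg (by positivity), div_eq_mul_inv]

lemma ofReal_div_rpow_eq_cutoffPow {x y γ α μ : ℝ} (hx : 0 ≤ x) (hy : 0 < y) :
    ((y ^ γ / (x * y ^ α + 1) ^ μ : ℝ) : ℂ) = cutoffPow α 0 γ μ x y := by
  rw [div_rpow_eq_mul_rpow_neg hx hy, cutoffPow, Complex.ofReal_mul, Complex.ofReal_cpow hy.le]

lemma cutoff_rpow_le {x y α μ : ℝ} (hx : 0 < x) (hy : 0 < y) (hμ : 0 ≤ μ) :
    (x * y ^ α + 1) ^ (-μ) ≤ x ^ (-μ) * y ^ (-(α * μ)) := by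
  rw [show -(α * μ) = α * (-μ) by ring, Real.rpow_mul hy.le,
    ← Real.mul_rpow hx.le (by positivity)]
  exact Real.rpow_le_rpow_of_nonpos (by positivity) (by linarith) (by linarith)

lemma div_rpow_le {x y γ α μ : ℝ} (hx : 0 < x) (hy : 0 < y) (hμ : 0 ≤ μ) :
    y ^ γ / (x * y ^ α + 1) ^ μ ≤ x ^ (-μ) * y ^ (γ - α * μ) := by
  rw [div_rpow_eq_mul_rpow_neg hx.le hy, sub_eq_add_neg, Real.rpow_add hy]
  calc _ ≤ y ^ γ * (x ^ (-μ) * y ^ (-(α * μ))) := by gcongr; exact cutoff_rpow_le hx hy hμ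
    _ = _ := by ring

lemma summable_gTerm {a γ α μ x : ℝ} (ha : 0 < a) (hμ0 : 0 ≤ μ) (hμ : γ + 1 < α * μ)
    (hx : 0 < x) : Summable (gTerm a γ α μ x) := by
  refine Summable.of_nonneg_of_le (fun k => ?_) (fun k => ?_)
    ((summable_add_rpow ha (by linarith : γ - α * μ < -1)).mul_left (x ^ (-μ)))
  · unfold gTerm; positivity
  · exact div_rpow_le hx (by positivity) hμ0

lemma integrableOn_div_rpow {a γ α μ x : ℝ} (ha : 0 < a) (hμ0 : 0 ≤ μ) (hμ : γ + 1 < α * μ)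
    (hx : 0 < x) : MeasureTheory.IntegrableOn (fun y => y ^ γ / (x * y ^ α + 1) ^ μ)
      (Set.Ioi a) := by
  refine MeasureTheory.Integrable.mono' ((integrableOn_Ioi_rpow_of_lt
    (by linarith : γ - α * μ < -1) ha).const_mul (x ^ (-μ))) ?_ ?_
  · refine ContinuousOn.aestronglyMeasurable (fun y hy => ?_) measurableSet_Ioi
    have hy0 : 0 < y := ha.trans hy
    have : x * y ^ α + 1 ≠ 0 := by positivity
    exact ((Real.continuousAt_rpow_const _ _ (Or.inl hy0.ne')).div
      ((((Real.continuousAt_rpow_const _ _ (Or.inl hy0.ne')).const_mul x).add_const 1).rpow_const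
        (Or.inl this)) (by positivity)).continuousWithinAt
  · refine (MeasureTheory.ae_restrict_iff' measurableSet_Ioi).mpr (Eventually.of_forall ?_)
    intro y hy
    have hy0 : 0 < y := ha.trans hy
    rw [Real.norm_of_nonneg (by positivity)]
    exact div_rpow_le hx hy0 hμ0

/-- The integral over `[a, ∞)` of the function whose values at `k + a` are summed in
`gSeries`. -/
noncomputable def gIntegral (a γ α μ x : ℝ) : ℝ :=
  ∫ y in Set.Ioi a, y ^ γ / (x * y ^ α + 1) ^ μ

lemma exists_norm_cutoffPow_le_rpow {α : ℝ} (j : ℕ) (γ : ℝ) {ν : ℝ} (hν : 0 ≤ ν) :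
    ∃ C : ℝ, 0 ≤ C ∧ ∀ x : ℝ, 0 ≤ x → ∀ y : ℝ, 0 < y →
      ‖cutoffPow α j γ ν x y‖ ≤ C * y ^ (γ - j) := by
  obtain ⟨C, hC, H⟩ := exists_norm_cutoffPow_le (α := α) j ‖(γ : ℂ)‖ hν
  refine ⟨C, hC, fun x hx y hy => (H γ le_rfl x hx y hy).trans
    (mul_le_mul_of_nonneg_left ?_ hC)⟩
  have : 0 ≤ x * y ^ α := by positivity
  exact mul_le_of_le_one_right (by positivity)
    (Real.rpow_le_one_of_one_le_of_nonpos (by linarith) (by linarith))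

lemma continuousOn_cutoffPow {α : ℝ} (j : ℕ) (s : ℂ) (ν : ℝ) {x : ℝ} (hx : 0 ≤ x) :
    ContinuousOn (cutoffPow α j s ν x) (Set.Ioi 0) := fun _ hy =>
  (hasDerivAt_cutoffPow hx hy j s ν).continuousAt.continuousWithinAt

lemma gSeries_sub_gIntegral {a γ α μ x : ℝ} {M : ℕ} (ha : 0 < a) (hμ0 : 0 ≤ μ)
    (hμ : γ + 1 < α * μ) (hx : 0 < x) (hM0 : M ≠ 0) (hM : γ - M < -1) :
    ((gSeries a γ α μ x - gIntegral a γ α μ x : ℝ) : ℂ) =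
      emConst M (fun j => cutoffPow α j γ μ x) a := by
  obtain ⟨D, hD, H⟩ := exists_norm_cutoffPow_le_rpow (α := α) M γ hμ0
  have hdecay (j : ℕ) : Tendsto (cutoffPow α j γ μ x) atTop (𝓝 0) := by
    obtain ⟨C, hC, HC⟩ := exists_norm_cutoffPow_le (α := α) j ‖(γ : ℂ)‖ hμ0
    refine squeeze_zero_norm' (a := fun y => C * (x ^ (-μ) * y ^ (-(α * μ + j - γ)))) ?_ ?_
    · filter_upwards [eventually_gt_atTop 0] with y hy
      refine (HC γ le_rfl x hx.le y hy).trans (mul_le_mul_of_nonneg_left ?_ hC)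
      rw [show -(α * μ + j - γ) = (γ - j) + -(α * μ) by ring, Real.rpow_add hy, Complex.ofReal_re]
      calc _ ≤ y ^ (γ - j) * (x ^ (-μ) * y ^ (-(α * μ))) := by
            gcongr; exact cutoff_rpow_le hx hy hμ0
        _ = _ := by ring
    · have hj : (0 : ℝ) ≤ j := j.cast_nonneg
      simpa using ((tendsto_rpow_neg_atTop (by linarith : 0 < α * μ + j - γ)).const_mul
        (x ^ (-μ))).const_mul C
  refine tendsto_nhds_unique ?_ (tendsto_sum_sub_integral_emConst ha hM0
    (fun j t ht => hasDerivAt_cutoffPow hx.le ht j γ μ) (fun j _ => hdecay j) hD hM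
    (H x hx.le))
  have h1 := (summable_gTerm ha hμ0 hμ hx).hasSum.tendsto_sum_nat
  have h2 := MeasureTheory.intervalIntegral_tendsto_integral_Ioi a
    (integrableOn_div_rpow ha hμ0 hμ hx)
    (tendsto_atTop_add_const_right atTop a (tendsto_natCast_atTop_atTop (R := ℝ)))
  refine ((Complex.continuous_ofReal.tendsto _).comp (h1.sub h2)).congr fun K => ?_
  simp only [Function.comp, Complex.ofReal_sub, Complex.ofReal_sum]
  congr 1
  · exact Finset.sum_congr rfl fun k _ => ofReal_div_rpow_eq_cutoffPow hx.le (by positivity)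
  · rw [← intervalIntegral.integral_ofReal]
    refine intervalIntegral.integral_congr fun t ht => ?_
    rw [Set.uIcc_of_le (by simp)] at ht
    exact ofReal_div_rpow_eq_cutoffPow hx.le (ha.trans_le ht.1)

lemma summable_emRem_cutoffPow {α γ ν x a : ℝ} {M : ℕ} (ha : 0 < a) (hM : γ - M < -1)
    (hν : 0 ≤ ν) (hx : 0 ≤ x) :
    Summable fun n : ℕ => emRem M (cutoffPow α M γ ν x) (n + a) := by
  obtain ⟨B, hB, HB⟩ := exists_norm_cutoffPow_le_rpow (α := α) M γ hν
  exact summable_emRem ha hB hM (HB x hx)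

lemma emConst_cutoffPowRem {a γ α μ x : ℝ} {M N : ℕ} (ha : 0 < a) (hα : 0 < α) (hμ : 0 ≤ μ)
    (hx : 0 ≤ x) (hM : γ + α * N - M < -1) :
    emConst M (fun j => cutoffPowRem α N j γ μ x) a =
      emConst M (fun j => cutoffPow α j γ μ x) a -
      ∑ k ∈ Finset.range N, (negBinomCoeff μ k : ℂ) * (x : ℂ) ^ k *
        emConst M (fun j => cutoffPow α j ((γ + α * k : ℝ) : ℂ) 0 0) a := by
  have hlt (k : ℕ) (hk : k ≤ N) : γ + α * k - M < -1 := by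
    have : α * k ≤ α * N := by gcongr
    linarith
  have hγ : γ - M < -1 := by simpa using hlt 0 N.zero_le
  have h := emConst_sub_sum (M := M) (N := N) (F := fun j => cutoffPow α j γ μ x)
    (G := fun k j => cutoffPow α j ((γ + α * k : ℝ) : ℂ) 0 0)
    (fun k => (negBinomCoeff μ k : ℂ) * (x : ℂ) ^ k) ha
    (continuousOn_cutoffPow M _ _ hx) (fun k _ => continuousOn_cutoffPow M _ _ le_rfl)
    (summable_emRem_cutoffPow ha hγ hμ hx)
    (fun k hk => summable_emRem_cutoffPow ha (hlt k hk.le) le_rfl le_rfl)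
  rw [h]
  congr 1
  ext j t
  simp [cutoffPowRem]

lemma exists_norm_emConst_cutoffPowRem_le {a γ α μ : ℝ} {M : ℕ} (ha : 0 < a) (hμ : 0 < μ)
    (N : ℕ) (hM : γ + α * N - M < -1) :
    ∃ C : ℝ, ∀ x : ℝ, 0 < x → ‖emConst M (fun j => cutoffPowRem α N j γ μ x) a‖ ≤ C * x ^ N := by
  choose D hD HD using fun j => exists_norm_cutoffPowRem_le (α := α) N j γ hμ
  simp only [Complex.ofReal_re] at HD
  obtain ⟨C, hC, HC⟩ := exists_norm_emRem_le M
  have hs := summable_add_rpow ha hM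
  refine ⟨(∑ j ∈ Finset.range M, ‖emCoeff j‖ * (D j * a ^ (γ + α * N - j))) +
    C * D M * ∑' n : ℕ, ((n : ℝ) + a) ^ (γ + α * N - M), fun x hx => ?_⟩
  rw [emConst, add_mul, Finset.sum_mul]
  refine (norm_add_le _ _).trans (add_le_add ?_ ?_)
  · rw [norm_neg]
    refine (norm_sum_le _ _).trans (Finset.sum_le_sum fun j _ => ?_)
    rw [norm_mul, mul_assoc ‖_‖]
    refine mul_le_mul_of_nonneg_left ((HD j x hx.le a ha).trans (le_of_eq ?_)) (norm_nonneg _)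
    ring
  · have hb (n : ℕ) : ‖emRem M (cutoffPowRem α N M γ μ x) (n + a)‖ ≤
        C * (D M * x ^ N) * ((n : ℝ) + a) ^ (γ + α * N - M) :=
      norm_emRem_le_of_rpow HC (mul_nonneg (hD M) (by positivity)) (by linarith)
        (fun y hy => HD M x hx.le y hy) (by positivity)
    refine (tsum_of_norm_bounded ((hs.hasSum).mul_left _) hb).trans (le_of_eq ?_)
    ring

/-- The difference of the series and the integral has a power series expansion in `x`, whose
coefficients are the Euler–Maclaurin constants of the pure powers `y ^ (γ + α * k)`. -/
lemma exists_norm_gSeries_sub_gIntegral_le {a γ α μ : ℝ} {M : ℕ} (ha : 0 < a) (hα : 0 < α)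
    (hμ0 : 0 < μ) (hμ : γ + 1 < α * μ) (N : ℕ) (hM0 : M ≠ 0) (hM : γ + α * N - M < -1) :
    ∃ C : ℝ, ∀ x : ℝ, 0 < x → ‖((gSeries a γ α μ x - gIntegral a γ α μ x : ℝ) : ℂ) -
      ∑ k ∈ Finset.range N, (negBinomCoeff μ k : ℂ) * (x : ℂ) ^ k *
        emConst M (fun j => cutoffPow α j ((γ + α * k : ℝ) : ℂ) 0 0) a‖ ≤ C * x ^ N := by
  obtain ⟨C, hC⟩ := exists_norm_emConst_cutoffPowRem_le (M := M) ha hμ0 N hM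
  refine ⟨C, fun x hx => ?_⟩
  have : 0 ≤ α * N := by positivity
  rw [gSeries_sub_gIntegral ha hμ0.le hμ hx hM0 (by linarith),
    ← emConst_cutoffPowRem ha hα hμ0.le hx.le hM]
  exact hC x hx

/-! ### The incomplete beta integral -/

/-- The incomplete beta integral `∫_ε^∞ u ^ (p - 1) * (1 + u) ^ (-μ)`. -/
noncomputable def betaTail (p μ ε : ℝ) : ℝ :=
  ∫ u in Set.Ioi ε, u ^ (p - 1) * (u + 1) ^ (-μ)

/-- The primitive of `ε ^ (s - 1)` on `ε > 0` without constant term. -/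
noncomputable def powPrimitive (s ε : ℝ) : ℝ := if s = 0 then Real.log ε else ε ^ s / s

/-- The incomplete beta integral with the first `N` terms of its singular expansion at `ε = 0`
removed. For `0 < p + N` its limit at `0` is the finite part of the integral over `(0, ∞)`. -/
noncomputable def betaTailReg (N : ℕ) (p μ ε : ℝ) : ℝ :=
  betaTail p μ ε + ∑ k ∈ Finset.range N, negBinomCoeff μ k * powPrimitive (p + k) ε

lemma hasDerivAt_powPrimitive (s : ℝ) {ε : ℝ} (hε : 0 < ε) :
    HasDerivAt (powPrimitive s) (ε ^ (s - 1)) ε := by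
  unfold powPrimitive
  split_ifs with h
  · simpa [h, Real.rpow_neg_one] using Real.hasDerivAt_log hε.ne'
  · refine ((Real.hasDerivAt_rpow_const (Or.inl hε.ne')).div_const s).congr_deriv ?_
    field_simp

lemma tendsto_rpow_zero_right {s : ℝ} (hs : 0 < s) :
    Tendsto (fun ε : ℝ => ε ^ s) (𝓝[>] 0) (𝓝 0) := by
  have h := (Real.continuousAt_rpow_const 0 s (Or.inr hs.le)).tendsto
  rw [Real.zero_rpow hs.ne'] at h
  exact h.mono_left nhdsWithin_le_nhds

lemma tendsto_powPrimitive {s : ℝ} (hs : 0 < s) :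
    Tendsto (powPrimitive s) (𝓝[>] 0) (𝓝 0) := by
  have e : powPrimitive s = fun ε => ε ^ s / s := by
    ext ε; simp [powPrimitive, hs.ne']
  rw [e]
  simpa using (tendsto_rpow_zero_right hs).div_const s

lemma exists_abs_negBinom_taylor_le (N : ℕ) {ν : ℝ} (hν : 0 < ν) :
    ∃ C : ℝ, 0 ≤ C ∧ ∀ u : ℝ, 0 ≤ u →
      |(u + 1) ^ (-ν) - ∑ k ∈ Finset.range N, negBinomCoeff ν k * u ^ k| ≤ C * u ^ N := by
  obtain ⟨C, hC, H⟩ := exists_norm_cutoffPowRem_le (α := 1) N 0 0 hν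
  refine ⟨C, hC, fun u hu => ?_⟩
  have h := H u hu 1 one_pos
  have e : cutoffPowRem 1 N 0 0 ν u 1 =
      (((u + 1) ^ (-ν) - ∑ k ∈ Finset.range N, negBinomCoeff ν k * u ^ k : ℝ) : ℂ) := by
    simp [cutoffPowRem, cutoffPow]
  rwa [e, Complex.norm_real, Real.norm_eq_abs, Real.one_rpow, mul_one] at h

lemma continuousOn_beta_integrand (p μ : ℝ) :
    ContinuousOn (fun u : ℝ => u ^ (p - 1) * (u + 1) ^ (-μ)) (Set.Ioi 0) := by
  intro u hu
  have hu' : 0 < u := hu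
  have : u + 1 ≠ 0 := by positivity
  exact ((Real.continuousAt_rpow_const _ _ (Or.inl hu'.ne')).mul
    ((continuousAt_id.add_const 1).rpow_const (Or.inl this))).continuousWithinAt

lemma integrableOn_beta_integrand {p μ ε : ℝ} (hμ : 0 ≤ μ) (hp : p < μ) (hε : 0 < ε) :
    MeasureTheory.IntegrableOn (fun u : ℝ => u ^ (p - 1) * (u + 1) ^ (-μ)) (Set.Ioi ε) := by
  refine (integrableOn_div_rpow (γ := p - 1) (α := 1) (x := 1) hε hμ (by linarith)
    one_pos).congr_fun (fun u hu => ?_) measurableSet_Ioi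
  have hu0 : 0 < u := hε.trans hu
  simp [Real.rpow_neg (by positivity : 0 ≤ u + 1), div_eq_mul_inv]

lemma hasDerivAt_betaTail {p μ ε : ℝ} (hμ : 0 ≤ μ) (hp : p < μ) (hε : 0 < ε) :
    HasDerivAt (betaTail p μ) (-(ε ^ (p - 1) * (ε + 1) ^ (-μ))) ε := by
  have hc := continuousOn_beta_integrand p μ
  have hint {u v : ℝ} (hu : 0 < u) (hv : 0 < v) : IntervalIntegrable
      (fun u : ℝ => u ^ (p - 1) * (u + 1) ^ (-μ)) MeasureTheory.volume u v :=
    (hc.mono fun t ht => (lt_min hu hv).trans_le ht.1).intervalIntegrable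
  have h := intervalIntegral.integral_hasDerivAt_right (hint one_pos hε)
    (hc.stronglyMeasurableAtFilter isOpen_Ioi ε hε) (hc.continuousAt (Ioi_mem_nhds hε))
  refine (h.const_sub (betaTail p μ 1)).congr_of_eventuallyEq ?_
  filter_upwards [lt_mem_nhds hε] with t ht
  have := intervalIntegral.integral_interval_add_Ioi
    (integrableOn_beta_integrand hμ hp one_pos) (integrableOn_beta_integrand hμ hp ht)
  simp only [betaTail]
  linarith

lemma hasDerivAt_betaTailReg (N : ℕ) {p μ ε : ℝ} (hμ : 0 ≤ μ) (hp : p < μ) (hε : 0 < ε) :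
    HasDerivAt (betaTailReg N p μ) (-(ε ^ (p - 1) *
      ((ε + 1) ^ (-μ) - ∑ k ∈ Finset.range N, negBinomCoeff μ k * ε ^ k))) ε := by
  refine ((hasDerivAt_betaTail hμ hp hε).add (HasDerivAt.fun_sum fun (k : ℕ) _ =>
    (hasDerivAt_powPrimitive (p + k) hε).const_mul (negBinomCoeff μ k))).congr_deriv ?_
  rw [mul_sub, neg_sub, Finset.mul_sum, neg_add_eq_sub]
  congr 1
  refine Finset.sum_congr rfl fun k _ => ?_
  rw [add_sub_right_comm, Real.rpow_add_natCast hε.ne']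
  ring

/-- A limit at `0` of the regularized incomplete beta integral is attained at the rate
`ε ^ (p + N)`, the derivative being a Taylor remainder of `(1 + u) ^ (-μ)`. -/
lemma abs_betaTailReg_sub_le {N : ℕ} {p μ C L : ℝ} (hμ : 0 ≤ μ) (hp : p < μ) (hN : 0 < p + N)
    (hC : ∀ u : ℝ, 0 ≤ u →
      |(u + 1) ^ (-μ) - ∑ k ∈ Finset.range N, negBinomCoeff μ k * u ^ k| ≤ C * u ^ N)
    (hL : Tendsto (betaTailReg N p μ) (𝓝[>] 0) (𝓝 L)) {ε : ℝ} (hε : 0 < ε) :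
    |betaTailReg N p μ ε - L| ≤ C / (p + N) * ε ^ (p + N) := by
  have hbd {t : ℝ} (ht : 0 < t) : |-(t ^ (p - 1) *
      ((t + 1) ^ (-μ) - ∑ k ∈ Finset.range N, negBinomCoeff μ k * t ^ k))| ≤
      C / (p + N) * ((p + N) * t ^ (p + N - 1)) := by
    rw [abs_neg, abs_mul, abs_of_pos (Real.rpow_pos_of_pos ht _), add_sub_right_comm,
      Real.rpow_add_natCast ht.ne', ← mul_assoc, div_mul_cancel₀ _ hN.ne']
    calc _ ≤ t ^ (p - 1) * (C * t ^ N) := by gcongr; exact hC t ht.le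
      _ = _ := by ring
  have hpow {t : ℝ} (ht : 0 < t) : HasDerivAt (fun t : ℝ => C / (p + N) * t ^ (p + N))
      (C / (p + N) * ((p + N) * t ^ (p + N - 1))) t :=
    (Real.hasDerivAt_rpow_const (Or.inl ht.ne')).const_mul _
  have hlim : Tendsto (fun t : ℝ => C / (p + N) * t ^ (p + N)) (𝓝[>] 0) (𝓝 0) := by
    simpa using (tendsto_rpow_zero_right hN).const_mul (C / (p + N))
  -- adding or subtracting the primitive of the bound makes the function monotone
  have hmono : MonotoneOn (fun t => betaTailReg N p μ t + C / (p + N) * t ^ (p + N))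
      (Set.Ioi 0) := by
    have hd {t : ℝ} (ht : 0 < t) := (hasDerivAt_betaTailReg N hμ hp ht).add (hpow ht)
    refine monotoneOn_of_deriv_nonneg (convex_Ioi 0)
      (fun t ht => (hd ht).continuousAt.continuousWithinAt)
      (fun t ht => (hd (by simpa using ht)).differentiableAt.differentiableWithinAt) ?_
    intro t ht
    have ht0 : 0 < t := by simpa using ht
    have := (abs_le.mp (hbd ht0)).1
    refine le_of_le_of_eq ?_ (hd ht0).deriv.symm
    linarith
  have hanti : AntitoneOn (fun t => betaTailReg N p μ t - C / (p + N) * t ^ (p + N))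
      (Set.Ioi 0) := by
    have hd {t : ℝ} (ht : 0 < t) := (hasDerivAt_betaTailReg N hμ hp ht).sub (hpow ht)
    refine antitoneOn_of_deriv_nonpos (convex_Ioi 0)
      (fun t ht => (hd ht).continuousAt.continuousWithinAt)
      (fun t ht => (hd (by simpa using ht)).differentiableAt.differentiableWithinAt) ?_
    intro t ht
    have ht0 : 0 < t := by simpa using ht
    have := (abs_le.mp (hbd ht0)).2
    refine le_of_eq_of_le (hd ht0).deriv ?_
    linarith
  have hev : ∀ᶠ t in 𝓝[>] (0 : ℝ), t ∈ Set.Ioi 0 ∧ t ≤ ε :=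
    Filter.Eventually.and self_mem_nhdsWithin
      (mem_nhdsWithin_of_mem_nhds (eventually_le_nhds hε))
  rw [abs_le]
  constructor
  · have h := le_of_tendsto (hL.add hlim) (hev.mono fun t ht => hmono ht.1 hε ht.2)
    simp only at h
    linarith
  · have h := ge_of_tendsto (hL.sub hlim) (hev.mono fun t ht => hanti ht.1 hε ht.2)
    simp only at h
    linarith

/-- Integration by parts shifts `(p, μ)` to `(p + 1, μ + 1)`. -/
lemma betaTail_eq_betaTail_add_one {p μ ε : ℝ} (hμ : 0 ≤ μ) (hp : p < μ) (hp0 : p ≠ 0)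
    (hε : 0 < ε) : betaTail p μ ε =
      -(ε ^ p / p * (ε + 1) ^ (-μ)) + μ / p * betaTail (p + 1) (μ + 1) ε := by
  have hd : ∀ u ∈ Set.Ici ε, HasDerivAt (fun u : ℝ => u ^ p * (u + 1) ^ (-μ))
      (p * (u ^ (p - 1) * (u + 1) ^ (-μ)) -
        μ * (u ^ (p + 1 - 1) * (u + 1) ^ (-(μ + 1)))) u := by
    intro u hu
    have hu0 : 0 < u := hε.trans_le hu
    have h1 : HasDerivAt (fun u : ℝ => (u + 1) ^ (-μ)) (1 * (-μ) * (u + 1) ^ (-μ - 1)) u :=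
      ((hasDerivAt_id u).add_const 1).rpow_const (Or.inl (by simp; positivity))
    refine ((Real.hasDerivAt_rpow_const (Or.inl hu0.ne')).mul h1).congr_deriv ?_
    rw [show -(μ + 1) = -μ - 1 by ring, add_sub_cancel_right]
    ring
  have hi₁ := (integrableOn_beta_integrand hμ hp hε).const_mul p
  have hi₂ := (integrableOn_beta_integrand (by linarith : 0 ≤ μ + 1)
    (by linarith : p + 1 < μ + 1) hε).const_mul μ
  have hlim : Tendsto (fun u : ℝ => u ^ p * (u + 1) ^ (-μ)) atTop (𝓝 0) := by
    refine squeeze_zero' ?_ ?_ (tendsto_rpow_neg_atTop (by linarith : 0 < μ - p))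
    · filter_upwards [eventually_gt_atTop 0] with u hu
      positivity
    · filter_upwards [eventually_gt_atTop 0] with u hu
      rw [show -(μ - p) = p + -μ by ring, Real.rpow_add hu]
      exact mul_le_mul_of_nonneg_left (Real.rpow_le_rpow_of_nonpos hu (by linarith)
        (by linarith)) (by positivity)
  have h := MeasureTheory.integral_Ioi_of_hasDerivAt_of_tendsto' hd (hi₁.sub hi₂) hlim
  rw [MeasureTheory.integral_sub hi₁ hi₂, MeasureTheory.integral_const_mul,
    MeasureTheory.integral_const_mul] at h
  change p * betaTail p μ ε - μ * betaTail (p + 1) (μ + 1) ε = _ at h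
  field_simp
  linarith

lemma mul_powPrimitive (s : ℝ) {ε : ℝ} :
    s * powPrimitive s ε = ε ^ s - if s = 0 then 1 else 0 := by
  unfold powPrimitive
  split_ifs with h
  · simp [h]
  · field_simp
    ring

/-- Integration by parts for the regularized integral. The term `ε ^ 0` at a pole `p + k = 0` is not
absorbed by a primitive, and contributes the constant in the last sum. -/
lemma betaTailReg_succ (N : ℕ) {p μ ε : ℝ} (hμ : 0 < μ) (hp : p < μ) (hp0 : p ≠ 0)
    (hε : 0 < ε) : betaTailReg (N + 1) p μ ε = μ / p * betaTailReg N (p + 1) (μ + 1) ε -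
      ε ^ p * ((ε + 1) ^ (-μ) - ∑ k ∈ Finset.range (N + 1), negBinomCoeff μ k * ε ^ k) / p -
      (∑ k ∈ Finset.range (N + 1), if p + k = 0 then negBinomCoeff μ k else 0) / p := by
  have hshift : μ * ∑ k ∈ Finset.range N, negBinomCoeff (μ + 1) k * powPrimitive (p + 1 + k) ε =
      -∑ k ∈ Finset.range (N + 1), negBinomCoeff μ k * k * powPrimitive (p + k) ε := by
    rw [Finset.sum_range_succ', Finset.mul_sum]
    simp only [CharP.cast_eq_zero, mul_zero, zero_mul, add_zero]
    rw [← Finset.sum_neg_distrib]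
    refine Finset.sum_congr rfl fun k _ => ?_
    have h := negBinomCoeff_succ hμ k
    have e : p + ((k + 1 : ℕ) : ℝ) = p + 1 + k := by push_cast; ring
    rw [e]
    push_cast
    linear_combination powPrimitive (p + 1 + k) ε * h
  have hterm : ∑ k ∈ Finset.range (N + 1), negBinomCoeff μ k * powPrimitive (p + k) ε * p +
      ∑ k ∈ Finset.range (N + 1), negBinomCoeff μ k * k * powPrimitive (p + k) ε =
      ε ^ p * ∑ k ∈ Finset.range (N + 1), negBinomCoeff μ k * ε ^ k -
      ∑ k ∈ Finset.range (N + 1), if p + k = 0 then negBinomCoeff μ k else 0 := by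
    rw [← Finset.sum_add_distrib, Finset.mul_sum, ← Finset.sum_sub_distrib]
    refine Finset.sum_congr rfl fun k _ => ?_
    have h := mul_powPrimitive (p + k) (ε := ε)
    rw [Real.rpow_add_natCast hε.ne'] at h
    have e : (if p + k = 0 then negBinomCoeff μ k else 0) =
        negBinomCoeff μ k * if p + k = 0 then 1 else 0 := by simp
    rw [e]
    linear_combination negBinomCoeff μ k * h
  rw [← Finset.sum_mul] at hterm
  simp only [betaTailReg]
  rw [betaTail_eq_betaTail_add_one hμ.le hp hp0 hε]
  field_simp
  linear_combination hterm - hshift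

lemma tendsto_betaTailReg_succ {N : ℕ} {p μ L : ℝ} (hμ : 0 < μ) (hp : p < μ) (hp0 : p ≠ 0)
    (hN : 0 < p + 1 + N) (hL : Tendsto (betaTailReg N (p + 1) (μ + 1)) (𝓝[>] 0) (𝓝 L)) :
    Tendsto (betaTailReg (N + 1) p μ) (𝓝[>] 0) (𝓝 (μ / p * L -
      (∑ k ∈ Finset.range (N + 1), if p + k = 0 then negBinomCoeff μ k else 0) / p)) := by
  obtain ⟨C, hC, H⟩ := exists_abs_negBinom_taylor_le (N + 1) hμ
  have hrem : Tendsto (fun ε : ℝ => ε ^ p * ((ε + 1) ^ (-μ) -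
      ∑ k ∈ Finset.range (N + 1), negBinomCoeff μ k * ε ^ k)) (𝓝[>] 0) (𝓝 0) := by
    have h := (tendsto_rpow_zero_right hN).const_mul C
    rw [mul_zero] at h
    refine squeeze_zero_norm' ?_ h
    filter_upwards [self_mem_nhdsWithin] with ε hε
    have hε0 : 0 < ε := hε
    rw [norm_mul, Real.norm_of_nonneg (by positivity), Real.norm_eq_abs,
      show p + 1 + N = p + (N + 1 : ℕ) by push_cast; ring, Real.rpow_add_natCast hε0.ne']
    calc _ ≤ ε ^ p * (C * ε ^ (N + 1)) := by gcongr; exact H ε hε0.le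
      _ = _ := by ring
  have h := ((hL.const_mul (μ / p)).sub (hrem.div_const p)).sub_const
    ((∑ k ∈ Finset.range (N + 1), if p + k = 0 then negBinomCoeff μ k else 0) / p)
  rw [zero_div, sub_zero] at h
  refine h.congr' ?_
  filter_upwards [self_mem_nhdsWithin] with ε hε using (betaTailReg_succ N hμ hp hp0 hε).symm

/-! ### Finite parts of the beta integral -/

lemma image_div_add_one_Ioi :
    (fun u : ℝ => u / (u + 1)) '' Set.Ioi 0 = Set.Ioo 0 1 := by
  ext t
  simp only [Set.mem_image, Set.mem_Ioi, Set.mem_Ioo]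
  constructor
  · rintro ⟨u, hu, rfl⟩
    exact ⟨by positivity, by rw [div_lt_one (by positivity)]; linarith⟩
  · rintro ⟨h0, h1⟩
    have : 0 < 1 - t := by linarith
    refine ⟨t / (1 - t), by positivity, ?_⟩
    field_simp
    ring

/-- The beta integral over `(0, ∞)`, from the one over `(0, 1)` by `t = u / (u + 1)`. -/
lemma integrableOn_and_integral_beta_Ioi {p q : ℝ} (hp : 0 < p) (hq : 0 < q) :
    MeasureTheory.IntegrableOn (fun u : ℝ => u ^ (p - 1) * (u + 1) ^ (-(p + q))) (Set.Ioi 0) ∧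
    ∫ u in Set.Ioi (0 : ℝ), u ^ (p - 1) * (u + 1) ^ (-(p + q)) =
      Real.Gamma p * Real.Gamma q / Real.Gamma (p + q) := by
  have hder : ∀ u ∈ Set.Ioi (0 : ℝ), HasDerivWithinAt (fun u : ℝ => u / (u + 1))
      (1 / (u + 1) ^ 2) (Set.Ioi 0) u := by
    intro u hu
    have h1 : u + 1 ≠ 0 := by have : 0 < u := hu; positivity
    refine (((hasDerivAt_id u).div ((hasDerivAt_id u).add_const 1) h1).congr_deriv
      ?_).hasDerivWithinAt
    simp
  have hinj : Set.InjOn (fun u : ℝ => u / (u + 1)) (Set.Ioi 0) := by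
    intro u hu v hv h
    have hu' : 0 < u := hu
    have hv' : 0 < v := hv
    simp only at h
    field_simp at h
    linarith
  set b : ℝ → ℝ := fun t => t ^ (p - 1) * (1 - t) ^ (q - 1)
  have hcast : Set.EqOn (fun t : ℝ => (t : ℂ) ^ ((p : ℂ) - 1) * (1 - (t : ℂ)) ^ ((q : ℂ) - 1))
      (fun t => ((b t : ℝ) : ℂ)) (Set.Ioo 0 1) := by
    intro t ht
    simp only [b]
    rw [Complex.ofReal_mul, Complex.ofReal_cpow ht.1.le, Complex.ofReal_cpow (by linarith [ht.2])]
    push_cast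
    rfl
  have hbint : MeasureTheory.IntegrableOn b (Set.Ioo 0 1) := by
    have h := Complex.betaIntegral_convergent (u := p) (v := q) (by simpa) (by simpa)
    rw [intervalIntegrable_iff_integrableOn_Ioo_of_le zero_le_one] at h
    exact (h.congr_fun hcast measurableSet_Ioo).re
  have hbeta : ∫ t in Set.Ioo (0 : ℝ) 1, b t =
      Real.Gamma p * Real.Gamma q / Real.Gamma (p + q) := by
    have h := Complex.betaIntegral_eq_Gamma_mul_div p q (by simpa) (by simpa)
    rw [Complex.betaIntegral, intervalIntegral.integral_of_le zero_le_one,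
      MeasureTheory.integral_Ioc_eq_integral_Ioo,
      MeasureTheory.setIntegral_congr_fun measurableSet_Ioo hcast, integral_complex_ofReal,
      ← Complex.ofReal_add, Complex.Gamma_ofReal, Complex.Gamma_ofReal, Complex.Gamma_ofReal] at h
    exact_mod_cast h
  have hfun : Set.EqOn (fun u : ℝ => |1 / (u + 1) ^ 2| • b (u / (u + 1)))
      (fun u => u ^ (p - 1) * (u + 1) ^ (-(p + q))) (Set.Ioi 0) := by
    intro u hu
    have hu' : 0 < u := hu
    have h1 : 0 < u + 1 := by positivity
    have e : 1 - u / (u + 1) = (u + 1)⁻¹ := by field_simp; ring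
    have e2 : (u + 1) ^ (-(p + q)) =
        (u + 1) ^ (-2 : ℝ) * ((u + 1) ^ (-(p - 1)) * (u + 1) ^ (-(q - 1))) := by
      rw [← Real.rpow_add h1, ← Real.rpow_add h1]
      congr 1
      ring
    simp only [b, smul_eq_mul]
    rw [abs_of_pos (by positivity), e, Real.div_rpow hu'.le h1.le, Real.inv_rpow h1.le, e2,
      Real.rpow_neg h1.le, Real.rpow_neg h1.le, Real.rpow_neg h1.le, Real.rpow_two]
    field_simp
  rw [← image_div_add_one_Ioi] at hbint hbeta
  rw [MeasureTheory.integrableOn_image_iff_integrableOn_abs_deriv_smul measurableSet_Ioi hder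
    hinj] at hbint
  rw [MeasureTheory.integral_image_eq_integral_abs_deriv_smul measurableSet_Ioi hder hinj,
    MeasureTheory.setIntegral_congr_fun measurableSet_Ioi hfun] at hbeta
  exact ⟨hbint.congr_fun hfun measurableSet_Ioi, hbeta⟩

lemma tendsto_betaTail_of_pos {p μ : ℝ} (hp0 : 0 < p) (hp : p < μ) :
    Tendsto (betaTail p μ) (𝓝[>] 0)
      (𝓝 (Real.Gamma p * Real.Gamma (μ - p) / Real.Gamma μ)) := by
  obtain ⟨hint, hval⟩ := integrableOn_and_integral_beta_Ioi hp0 (by linarith : 0 < μ - p)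
  rw [add_sub_cancel] at hint hval
  have hc : ContinuousOn (fun ε : ℝ => ∫ u in (0 : ℝ)..ε, u ^ (p - 1) * (u + 1) ^ (-μ))
      (Set.uIcc 0 1) := by
    refine intervalIntegral.continuousOn_primitive_interval ?_
    rw [Set.uIcc_of_le zero_le_one, integrableOn_Icc_iff_integrableOn_Ioc]
    exact hint.mono_set fun t ht => ht.1
  have h0 := (hc 0 (by simp)).tendsto
  rw [intervalIntegral.integral_same] at h0
  have h1 : Tendsto (fun ε : ℝ => ∫ u in (0 : ℝ)..ε, u ^ (p - 1) * (u + 1) ^ (-μ))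
      (𝓝[>] 0) (𝓝 0) := by
    refine h0.mono_left ?_
    rw [Set.uIcc_of_le zero_le_one, ← nhdsWithin_Ioc_eq_nhdsGT one_pos]
    exact nhdsWithin_mono _ Set.Ioc_subset_Icc_self
  have h2 := h1.const_sub (Real.Gamma p * Real.Gamma (μ - p) / Real.Gamma μ)
  rw [sub_zero] at h2
  refine h2.congr' ?_
  filter_upwards [self_mem_nhdsWithin] with ε hε
  have hε0 : 0 < ε := hε
  rw [← hval, ← intervalIntegral.integral_interval_add_Ioi hint
    (hint.mono_set (Set.Ioi_subset_Ioi hε0.le))]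
  simp [betaTail]

lemma tendsto_betaTailReg_of_pos {N : ℕ} {p μ : ℝ} (hp0 : 0 < p) (hp : p < μ) :
    Tendsto (betaTailReg N p μ) (𝓝[>] 0)
      (𝓝 (Real.Gamma p * Real.Gamma (μ - p) / Real.Gamma μ)) := by
  have h := (tendsto_betaTail_of_pos hp0 hp).add (tendsto_finsetSum (Finset.range N)
    fun k _ => (tendsto_powPrimitive (by positivity : 0 < p + (k : ℝ))).const_mul
      (negBinomCoeff μ k))
  simp only [mul_zero, Finset.sum_const_zero, add_zero] at h
  exact h

/-- The finite part of the beta integral over `(0, ∞)` continues the beta function to all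
`p < μ` which are not poles of `Γ(p)`. -/
lemma tendsto_betaTailReg_of_ne {N : ℕ} {p μ : ℝ} (hμ : 0 < μ) (hp : p < μ) (hN : 0 < p + N)
    (hp' : ∀ r : ℕ, p ≠ -r) : Tendsto (betaTailReg N p μ) (𝓝[>] 0)
      (𝓝 (Real.Gamma p * Real.Gamma (μ - p) / Real.Gamma μ)) := by
  induction N generalizing p μ with
  | zero => exact tendsto_betaTailReg_of_pos (by simpa using hN) hp
  | succ N ih =>
    have hp0 : p ≠ 0 := by simpa using hp' 0
    have hN' : 0 < p + 1 + N := by push_cast at hN; linarith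
    have h := ih (p := p + 1) (μ := μ + 1) (by linarith) (by linarith) hN' fun r h =>
      hp' (r + 1) (by push_cast; linarith)
    have h2 := tendsto_betaTailReg_succ hμ hp hp0 hN' h
    rw [Finset.sum_eq_zero (fun k _ => if_neg fun h => hp' k (by linarith)), zero_div, sub_zero,
      Real.Gamma_add_one hp0, Real.Gamma_add_one hμ.ne', add_sub_add_right_eq_sub] at h2
    convert h2 using 2
    have := (Real.Gamma_pos_of_pos hμ).ne'
    field_simp

lemma tendsto_betaTail_exponent {μ ε : ℝ} (hμ : 0 < μ) (hε : 0 < ε) :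
    Tendsto (fun p => betaTail p μ ε) (𝓝[>] 0) (𝓝 (betaTail 0 μ ε)) := by
  have hi (p : ℝ) (hp : p < μ) := integrableOn_beta_integrand hμ.le hp hε
  refine MeasureTheory.tendsto_integral_filter_of_dominated_convergence
    (fun u => u ^ ((0 : ℝ) - 1) * (u + 1) ^ (-μ) + u ^ (μ / 2 - 1) * (u + 1) ^ (-μ)) ?_ ?_
    ((hi 0 hμ).add (hi (μ / 2) (by linarith))) ?_
  · have : ∀ᶠ p in 𝓝[>] (0 : ℝ), p < μ := mem_nhdsWithin_of_mem_nhds (eventually_lt_nhds hμ)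
    filter_upwards [this] with p hp using (hi p hp).aestronglyMeasurable
  · have : ∀ᶠ p in 𝓝[>] (0 : ℝ), p < μ / 2 :=
      mem_nhdsWithin_of_mem_nhds (eventually_lt_nhds (by positivity))
    filter_upwards [this, self_mem_nhdsWithin] with p hp hp0
    refine (MeasureTheory.ae_restrict_iff' measurableSet_Ioi).mpr (Eventually.of_forall ?_)
    intro u hu
    have hu0 : 0 < u := hε.trans hu
    have hp0' : 0 < p := hp0
    rw [Real.norm_of_nonneg (by positivity), ← add_mul]
    gcongr
    exact rpow_le_rpow_add_rpow hu0 (by linarith) (by linarith)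
  · refine (MeasureTheory.ae_restrict_iff' measurableSet_Ioi).mpr (Eventually.of_forall ?_)
    intro u hu
    have hu0 : 0 < u := hε.trans hu
    have hc : Continuous fun p : ℝ => u ^ (p - 1) * (u + 1) ^ (-μ) :=
      ((Real.continuous_const_rpow hu0.ne').comp (continuous_sub_right 1)).mul continuous_const
    exact (hc.tendsto 0).mono_left nhdsWithin_le_nhds

/-- The constant term at the pole `p = 0` of the beta function. -/
lemma tendsto_beta_sub_inv {μ : ℝ} (hμ : 0 < μ) :
    Tendsto (fun p => Real.Gamma p * Real.Gamma (μ - p) / Real.Gamma μ - p⁻¹) (𝓝[>] 0)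
      (𝓝 (deriv Real.Gamma 1 / Real.Gamma 1 - deriv Real.Gamma μ / Real.Gamma μ)) := by
  have hG := (Real.Gamma_pos_of_pos hμ).ne'
  have h1 : HasDerivAt (fun p : ℝ => Real.Gamma (p + 1)) (deriv Real.Gamma 1) 0 := by
    have := hasDerivAt_Gamma_of_pos one_pos
    rw [← zero_add (1 : ℝ)] at this
    simpa using this.comp_add_const 0 1
  have h2 : HasDerivAt (fun p : ℝ => Real.Gamma (μ - p)) (-deriv Real.Gamma μ) 0 := by
    have := hasDerivAt_Gamma_of_pos hμ
    rw [← sub_zero μ] at this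
    simpa using this.comp_const_sub μ 0
  have h3 := ((h1.mul h2).div_const (Real.Gamma μ)).tendsto_slope_zero_right
  simp only [zero_add, Pi.mul_apply, sub_zero, Real.Gamma_one, one_mul, smul_eq_mul] at h3
  rw [Real.Gamma_one, div_one]
  have e : (deriv Real.Gamma 1 * Real.Gamma μ + -deriv Real.Gamma μ) / Real.Gamma μ =
      deriv Real.Gamma 1 - deriv Real.Gamma μ / Real.Gamma μ := by field_simp; ring
  rw [e] at h3
  refine h3.congr' ?_
  filter_upwards [self_mem_nhdsWithin] with p hp
  have hp0 : 0 < p := hp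
  rw [Real.Gamma_add_one hp0.ne']
  field_simp

/-- The finite part of the beta integral at `p = 0`, as a limit from `p > 0`. -/
lemma tendsto_betaTailReg_one_zero {μ : ℝ} (hμ : 0 < μ) :
    Tendsto (betaTailReg 1 0 μ) (𝓝[>] 0)
      (𝓝 (deriv Real.Gamma 1 / Real.Gamma 1 - deriv Real.Gamma μ / Real.Gamma μ)) := by
  obtain ⟨C, hC, H⟩ := exists_abs_negBinom_taylor_le 1 hμ
  set L := deriv Real.Gamma 1 / Real.Gamma 1 - deriv Real.Gamma μ / Real.Gamma μ
  -- the bound for `p > 0` is uniform as `p → 0`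
  have hbound {ε : ℝ} (hε : 0 < ε) : |betaTailReg 1 0 μ ε - L| ≤ C * ε := by
    have hpow : Tendsto (fun p : ℝ => (ε ^ p - 1) / p) (𝓝[>] 0) (𝓝 (Real.log ε)) := by
      have h : HasDerivAt (fun p : ℝ => ε ^ p) (Real.log ε) 0 := by
        simpa using (hasDerivAt_id (0 : ℝ)).const_rpow hε
      simpa [div_eq_inv_mul] using h.tendsto_slope_zero_right
    -- subtracting the pole `1 / p` from both the regularized integral and its limit
    have hlim := (((tendsto_betaTail_exponent hμ hε).add hpow).sub
      (tendsto_beta_sub_inv hμ)).abs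
    have hrhs : Tendsto (fun p : ℝ => C / (p + 1) * ε ^ (p + 1)) (𝓝[>] 0) (𝓝 (C * ε)) := by
      have hc : ContinuousAt (fun p : ℝ => C / (p + 1) * ε ^ (p + 1)) 0 := by
        refine ContinuousAt.mul (continuousAt_const.div (by fun_prop) (by simp)) ?_
        exact ((Real.continuous_const_rpow hε.ne').comp (continuous_add_const 1)).continuousAt
      simpa using hc.tendsto.mono_left nhdsWithin_le_nhds
    have e : betaTailReg 1 0 μ ε = betaTail 0 μ ε + Real.log ε := by
      simp [betaTailReg, powPrimitive, negBinomCoeff_zero hμ]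
    rw [e]
    refine le_of_tendsto_of_tendsto hlim hrhs ?_
    have hpμ : ∀ᶠ p in 𝓝[>] (0 : ℝ), p < μ := mem_nhdsWithin_of_mem_nhds (eventually_lt_nhds hμ)
    filter_upwards [hpμ, self_mem_nhdsWithin] with p hp hp0
    have hp0' : 0 < p := hp0
    have h := abs_betaTailReg_sub_le (N := 1) hμ.le hp (by simp; linarith) H
      (tendsto_betaTailReg_of_pos hp0' hp) hε
    simp only [betaTailReg, Finset.sum_range_one, negBinomCoeff_zero hμ, powPrimitive,
      Nat.cast_zero, add_zero, hp0'.ne', if_false, one_mul, Nat.cast_one] at h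
    refine le_of_eq_of_le ?_ h
    congr 1
    field_simp
    ring
  refine tendsto_iff_norm_sub_tendsto_zero.mpr (squeeze_zero' (Eventually.of_forall fun _ =>
    norm_nonneg _) ?_ (g := fun ε => C * ε) ?_)
  · filter_upwards [self_mem_nhdsWithin] with ε hε using hbound hε
  · have : Continuous fun ε : ℝ => C * ε := by fun_prop
    simpa using (this.tendsto 0).mono_left nhdsWithin_le_nhds

/-- The finite part of the beta integral at the poles `p = -r` of `Γ(p)`. -/
lemma tendsto_betaTailReg_neg_natCast {N r : ℕ} {μ : ℝ} (hμ : 0 < μ) (hN : r < N) :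
    Tendsto (betaTailReg N (-r) μ) (𝓝[>] 0) (𝓝 (negBinomCoeff μ r *
      (deriv Real.Gamma (r + 1) / Real.Gamma (r + 1) -
        deriv Real.Gamma (μ + r) / Real.Gamma (μ + r)))) := by
  induction r generalizing N μ with
  | zero =>
    obtain ⟨N, rfl⟩ := Nat.exists_eq_succ_of_ne_zero hN.ne'
    have h := (tendsto_betaTailReg_one_zero hμ).add (tendsto_finsetSum (Finset.range N)
      fun k _ => (tendsto_powPrimitive (by positivity : 0 < (0 : ℝ) + ((k + 1 : ℕ) : ℝ))).const_mul
        (negBinomCoeff μ (k + 1)))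
    simp only [mul_zero, Finset.sum_const_zero, add_zero] at h
    simp only [Nat.cast_zero, neg_zero, zero_add, add_zero, negBinomCoeff_zero hμ, one_mul]
    refine h.congr fun ε => ?_
    simp only [betaTailReg, Nat.succ_eq_add_one, Finset.sum_range_succ', Finset.sum_range_zero]
    ring
  | succ r ih =>
    obtain ⟨N, rfl⟩ := Nat.exists_eq_succ_of_ne_zero (by omega : N ≠ 0)
    have hr : (0 : ℝ) < r + 1 := by positivity
    have hrN : (r : ℝ) < N := by exact_mod_cast (by omega : r < N)
    have e1 : -((r + 1 : ℕ) : ℝ) + 1 = -(r : ℝ) := by push_cast; ring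
    have h := ih (N := N) (μ := μ + 1) (by linarith) (by omega)
    rw [← e1] at h
    have h2 := tendsto_betaTailReg_succ hμ (by push_cast; linarith)
      (by push_cast; linarith) (by push_cast; linarith) h
    convert h2 using 2
    have hs : (∑ k ∈ Finset.range (N + 1),
        if -((r + 1 : ℕ) : ℝ) + k = 0 then negBinomCoeff μ k else 0) = negBinomCoeff μ (r + 1) := by
      rw [Finset.sum_eq_single (r + 1)]
      · simp
      · intro k _ hk
        refine if_neg fun h0 => hk ?_
        exact_mod_cast (by linarith : (k : ℝ) = ((r + 1 : ℕ) : ℝ))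
      · intro h0
        simp at h0
        omega
    rw [hs]
    have hc := negBinomCoeff_succ hμ r
    have hd := digamma_add_one hr
    have e2 : μ + ((r + 1 : ℕ) : ℝ) = μ + 1 + r := by push_cast; ring
    rw [e2]
    push_cast
    rw [hd]
    generalize deriv Real.Gamma (r + 1) / Real.Gamma (r + 1) = d₁
    generalize deriv Real.Gamma (μ + 1 + r) / Real.Gamma (μ + 1 + r) = d₂
    field_simp
    linear_combination (d₁ - d₂) * hc

/-! ### The asymptotic expansion -/

/-- The substitution `u = x * y ^ α`. -/
lemma gIntegral_eq_betaTail {a γ α μ x : ℝ} (ha : 0 < a) (hα : 0 < α) (hμ0 : 0 ≤ μ)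
    (hμ : (γ + 1) / α < μ) (hx : 0 < x) : gIntegral a γ α μ x =
      x ^ (-((γ + 1) / α)) / α * betaTail ((γ + 1) / α) μ (x * a ^ α) := by
  set p := (γ + 1) / α
  have hγ : γ = α * p - 1 := by simp only [p]; field_simp; ring
  have hμ' : γ + 1 < α * μ := by rw [div_lt_iff₀ hα] at hμ; linarith
  have hε : 0 < x * a ^ α := by positivity
  have hpos : ∀ y ∈ Set.Ici a, x * a ^ α ≤ x * y ^ α := fun y hy => by
    have : a ≤ y := hy
    gcongr
  have hfun : ∀ y, 0 < y → (x * y ^ α) ^ (p - 1) * (x * y ^ α + 1) ^ (-μ) *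
      (x * (α * y ^ (α - 1))) = α * x ^ p * (y ^ γ / (x * y ^ α + 1) ^ μ) := by
    intro y hy
    rw [div_rpow_eq_mul_rpow_neg hx.le hy, Real.mul_rpow hx.le (by positivity), ← Real.rpow_mul
      hy.le, Real.rpow_sub_one hx.ne', hγ, show α * p - 1 = α * (p - 1) + (α - 1) by ring,
      Real.rpow_add hy]
    field_simp
  have hcont : Continuous fun y : ℝ => x * y ^ α :=
    continuous_const.mul (Real.continuous_rpow_const hα.le)
  have h := MeasureTheory.integral_comp_mul_deriv_Ioi (a := a) (f := fun y => x * y ^ α)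
    (f' := fun y => x * (α * y ^ (α - 1))) (g := fun u => u ^ (p - 1) * (u + 1) ^ (-μ))
    hcont.continuousOn ((tendsto_rpow_atTop hα).const_mul_atTop hx)
    (fun y hy => ((Real.hasDerivAt_rpow_const
      (Or.inl (ha.trans hy).ne')).const_mul x).hasDerivWithinAt)
    ((continuousOn_beta_integrand p μ).mono ?_) ?_ ?_
  · simp only [Function.comp] at h
    rw [betaTail, ← h, MeasureTheory.setIntegral_congr_fun measurableSet_Ioi
      (fun y hy => hfun y (ha.trans hy)), MeasureTheory.integral_const_mul, gIntegral,
      Real.rpow_neg hx.le]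
    field_simp
  · rintro _ ⟨y, hy, rfl⟩
    exact hε.trans_le (hpos y (Set.Ioi_subset_Ici_self hy))
  · refine (integrableOn_beta_integrand hμ0 hμ (half_pos hε)).mono_set ?_
    rintro _ ⟨y, hy, rfl⟩
    have := hpos y hy
    simp only [Set.mem_Ioi]
    linarith
  · rw [integrableOn_Ici_iff_integrableOn_Ioi]
    exact MeasureTheory.IntegrableOn.congr_fun
      ((integrableOn_div_rpow ha hμ0 hμ' hx).const_mul (α * x ^ p))
      (fun y hy => (hfun y (ha.trans hy)).symm) measurableSet_Ioi

/-- The singular expansion of the integral at `x = 0`, with the finite part `L` of the beta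
integral as leading coefficient. -/
lemma exists_abs_gIntegral_sub_le {a γ α μ L : ℝ} {N : ℕ} (ha : 0 < a) (hα : 0 < α) (hμ0 : 0 < μ)
    (hμ : (γ + 1) / α < μ) (hN : 0 < (γ + 1) / α + N)
    (hL : Tendsto (betaTailReg N ((γ + 1) / α) μ) (𝓝[>] 0) (𝓝 L)) :
    ∃ C : ℝ, ∀ x : ℝ, 0 < x → |gIntegral a γ α μ x - x ^ (-((γ + 1) / α)) / α *
      (L - ∑ k ∈ Finset.range N, negBinomCoeff μ k *
        powPrimitive ((γ + 1) / α + k) (x * a ^ α))| ≤ C * x ^ N := by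
  obtain ⟨C, hC, H⟩ := exists_abs_negBinom_taylor_le N hμ0
  set p := (γ + 1) / α
  refine ⟨C / (p + N) * (a ^ α) ^ (p + N) / α, fun x hx => ?_⟩
  have hε : 0 < x * a ^ α := by positivity
  have h := abs_betaTailReg_sub_le hμ0.le hμ hN H hL hε
  rw [gIntegral_eq_betaTail ha hα hμ0.le hμ hx, ← mul_sub, abs_mul,
    abs_of_pos (by positivity : 0 < x ^ (-p) / α)]
  rw [betaTailReg] at h
  have e : x ^ (p + N) = x ^ p * x ^ N := Real.rpow_add_natCast hx.ne' p N
  rw [Real.mul_rpow hx.le (by positivity), e] at h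
  rw [← sub_add]
  rw [add_sub_right_comm] at h
  refine (mul_le_mul_of_nonneg_left h (by positivity)).trans (le_of_eq ?_)
  rw [Real.rpow_neg hx.le]
  field_simp

/-- A power series expansion holds to every order as soon as it holds to all large orders. -/
lemma hasAsymptoticPowerSeries_of_le {F : ℝ → ℂ} {c : ℕ → ℂ} (N₀ : ℕ)
    (h : ∀ N, N₀ ≤ N → ∃ C : ℝ, ∀ x : ℝ, 0 < x →
      ‖F x - ∑ k ∈ Finset.range N, c k * (x : ℂ) ^ k‖ ≤ C * x ^ N) :
    HasAsymptoticPowerSeries F c := by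
  have hpow (m n : ℕ) (hmn : m ≤ n) :
      (fun x : ℝ => x ^ n) =O[𝓝[>] (0 : ℝ)] fun x : ℝ => x ^ m := by
    refine IsBigO.of_bound 1 ?_
    have h1 : ∀ᶠ x : ℝ in 𝓝[>] 0, x ≤ 1 :=
      mem_nhdsWithin_of_mem_nhds (eventually_le_nhds one_pos)
    filter_upwards [h1, self_mem_nhdsWithin] with x hx hx0
    have hx0' : 0 < x := hx0
    rw [one_mul, Real.norm_of_nonneg (by positivity), Real.norm_of_nonneg (by positivity)]
    exact pow_le_pow_of_le_one hx0'.le hx hmn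
  intro N
  obtain ⟨C, hC⟩ := h (N + N₀) (Nat.le_add_left _ _)
  have h1 : (fun x : ℝ => F x - ∑ k ∈ Finset.range (N + N₀), c k * (x : ℂ) ^ k)
      =O[𝓝[>] (0 : ℝ)] fun x : ℝ => x ^ (N + N₀) := by
    refine IsBigO.of_bound C ?_
    filter_upwards [self_mem_nhdsWithin] with x hx
    have hx0 : 0 < x := hx
    rw [Real.norm_of_nonneg (by positivity : 0 ≤ x ^ (N + N₀))]
    exact hC x hx
  have h2 : (fun x : ℝ => ∑ k ∈ Finset.range N₀, c (N + k) * (x : ℂ) ^ (N + k))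
      =O[𝓝[>] (0 : ℝ)] fun x : ℝ => x ^ N := by
    refine IsBigO.fun_sum fun k _ => IsBigO.const_mul_left ?_ (c (N + k))
    refine IsBigO.trans (IsBigO.of_bound 1 (Eventually.of_forall fun x => ?_))
      (hpow N (N + k) (Nat.le_add_right _ _))
    simp
  refine ((h1.trans (hpow N (N + N₀) (Nat.le_add_right _ _))).add h2).congr_left fun x => ?_
  rw [Finset.sum_range_add]
  ring

/-- The common expansion of the series in all cases: the coefficients combine the
Euler–Maclaurin constants of the powers with the expansion of the incomplete beta integral. -/
lemma exists_norm_gSeries_sub_le {a γ α μ L : ℝ} {M N : ℕ} (ha : 0 < a) (hα : 0 < α)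
    (hμ0 : 0 < μ) (hμ : (γ + 1) / α < μ) (hN : 0 < (γ + 1) / α + N) (hM0 : M ≠ 0)
    (hM : γ + α * N - M < -1)
    (hL : Tendsto (betaTailReg N ((γ + 1) / α) μ) (𝓝[>] 0) (𝓝 L)) :
    ∃ C : ℝ, ∀ x : ℝ, 0 < x → ‖(gSeries a γ α μ x : ℂ) - ((x ^ (-((γ + 1) / α)) / α * L : ℝ) : ℂ) -
      ∑ k ∈ Finset.range N, (negBinomCoeff μ k : ℂ) *
        ((x : ℂ) ^ k * emConst M (fun j => cutoffPow α j ((γ + α * k : ℝ) : ℂ) 0 0) a -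
          ((x ^ (-((γ + 1) / α)) / α * powPrimitive ((γ + 1) / α + k) (x * a ^ α) : ℝ) : ℂ))‖ ≤
      C * x ^ N := by
  have hμ' : γ + 1 < α * μ := by rw [div_lt_iff₀ hα] at hμ; linarith
  obtain ⟨C₁, h₁⟩ := exists_norm_gSeries_sub_gIntegral_le ha hα hμ0 hμ' N hM0 hM
  obtain ⟨C₂, h₂⟩ := exists_abs_gIntegral_sub_le ha hα hμ0 hμ hN hL
  refine ⟨C₁ + C₂, fun x hx => ?_⟩
  have h2 := h₂ x hx
  rw [← Real.norm_eq_abs, ← Complex.norm_real] at h2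
  rw [add_mul]
  refine le_of_eq_of_le (congrArg _ ?_) ((norm_add_le _ _).trans (add_le_add (h₁ x hx) h2))
  push_cast
  simp only [mul_sub, Finset.sum_sub_distrib, Finset.mul_sum, ← mul_assoc]
  have e : ∑ k ∈ Finset.range N, (negBinomCoeff μ k : ℂ) * ((x ^ (-((γ + 1) / α)) : ℝ) : ℂ) / α *
      (powPrimitive ((γ + 1) / α + k) (x * a ^ α) : ℂ) = 0 + ∑ k ∈ Finset.range N,
      ((x ^ (-((γ + 1) / α)) : ℝ) : ℂ) / α * (negBinomCoeff μ k : ℂ) *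
      (powPrimitive ((γ + 1) / α + k) (x * a ^ α) : ℂ) := by
    rw [zero_add]
    exact Finset.sum_congr rfl fun k _ => by ring
  simp only [mul_div_assoc] at e ⊢
  rw [e]
  ring

/-- Away from the pole, the finite parts `a ^ (σ + 1) / (σ + 1)`, `σ = γ + α * k`, in the
Euler–Maclaurin constant and in the incomplete beta integral cancel. -/
lemma emConst_sub_powPrimitive {a γ α x : ℝ} {M k : ℕ} (ha : 0 < a) (hα : 0 < α) (hx : 0 < x)
    (hM0 : M ≠ 0) (hM : γ + α * k < M - 1) (hk : (γ + 1) / α + k ≠ 0) :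
    (x : ℂ) ^ k * emConst M (fun j => cutoffPow α j ((γ + α * k : ℝ) : ℂ) 0 0) a -
      ((x ^ (-((γ + 1) / α)) / α * powPrimitive ((γ + 1) / α + k) (x * a ^ α) : ℝ) : ℂ) =
      hurwitzZetaPos ((-α * k - γ : ℝ) : ℂ) a * (x : ℂ) ^ k := by
  have e1 : γ + α * k + 1 = α * ((γ + 1) / α + k) := by field_simp; ring
  have hσ : γ + α * k ≠ -1 := fun h => by
    have : α * ((γ + 1) / α + k) = 0 := by rw [← e1, h]; ring
    exact (mul_ne_zero hα.ne' hk) this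
  rw [emConst_pow ha hσ hM hM0]
  have e2 : x ^ (-((γ + 1) / α)) / α * powPrimitive ((γ + 1) / α + k) (x * a ^ α) =
      x ^ k * (a ^ (γ + α * k + 1) / (γ + α * k + 1)) := by
    rw [powPrimitive, if_neg hk, e1, Real.mul_rpow hx.le (by positivity), ← Real.rpow_mul ha.le,
      Real.rpow_add_natCast hx.ne', Real.rpow_neg hx.le]
    field_simp
  rw [e2]
  have e3 : ((a ^ (γ + α * k + 1) : ℝ) : ℂ) = (a : ℂ) ^ (((γ + α * k : ℝ) : ℂ) + 1) := by
    rw [Complex.ofReal_cpow ha.le]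
    push_cast
    rfl
  have e4 : ((-α * k - γ : ℝ) : ℂ) = -((γ + α * k : ℝ) : ℂ) := by push_cast; ring
  rw [e4, Complex.ofReal_mul, Complex.ofReal_div, e3]
  push_cast
  ring

/-- At the pole the Euler–Maclaurin constant and the logarithm in the incomplete beta integral
combine to `-ψ(a) - log x / α`. -/
lemma emConst_sub_powPrimitive_pole {a γ α x : ℝ} {M r : ℕ} (ha : 0 < a) (hα : 0 < α) (hx : 0 < x)
    (hM0 : M ≠ 0) (hr : -((γ + 1) / α) = r) :
    (x : ℂ) ^ r * emConst M (fun j => cutoffPow α j ((γ + α * r : ℝ) : ℂ) 0 0) a -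
      ((x ^ (-((γ + 1) / α)) / α * powPrimitive ((γ + 1) / α + r) (x * a ^ α) : ℝ) : ℂ) =
      ((x ^ r * (-Real.log x / α - deriv Real.Gamma a / Real.Gamma a) : ℝ) : ℂ) := by
  have hσ : γ + α * r = -1 := by rw [← hr]; field_simp; ring
  have h0 : (γ + 1) / α + r = 0 := by rw [← hr]; ring
  have e : ((γ + α * r : ℝ) : ℂ) = -1 := by rw [hσ]; norm_num
  rw [e, emConst_inv hM0 ha, hr, h0, powPrimitive, if_pos rfl, Real.rpow_natCast,
    Real.log_mul hx.ne' (by positivity), Real.log_rpow ha]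
  have : (α : ℂ) ≠ 0 := by exact_mod_cast hα.ne'
  push_cast
  field_simp
  ring

lemma gCoeff_eq (a γ α μ : ℝ) (k : ℕ) :
    gCoeff a γ α μ k = negBinomCoeff μ k * hurwitzZetaPos ((-α * k - γ : ℝ) : ℂ) a := rfl

theorem theorem1p3 (a γ α μ : ℝ) (ha : 0 < a) (hα : 0 < α) (hμ : max ((γ + 1) / α) 0 < μ) :
    (∀ x : ℝ, 0 < x → Summable (gTerm a γ α μ x)) ∧
    ((∀ r : ℕ, -((γ + 1) / α) ≠ r) →
      HasAsymptoticPowerSeries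
        (fun x : ℝ => ((gSeries a γ α μ x -
          Real.Gamma ((γ + 1) / α) * Real.Gamma (μ - (γ + 1) / α) / (α * Real.Gamma μ) *
            x ^ (-((γ + 1) / α)) : ℝ) : ℂ))
        (gCoeff a γ α μ)) ∧
    (∀ r : ℕ, -((γ + 1) / α) = r →
      HasAsymptoticPowerSeries
        (fun x : ℝ => ((gSeries a γ α μ x -
          Real.Gamma (μ + r) * (-1) ^ r * x ^ r / (Real.Gamma μ * Real.Gamma (r + 1)) *
            (-(Real.log x) / α
              + deriv Real.Gamma (r + 1) / (α * Real.Gamma (r + 1))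
              - deriv Real.Gamma a / Real.Gamma a
              - deriv Real.Gamma (μ + r) / (α * Real.Gamma (μ + r))) : ℝ) : ℂ))
        (fun k : ℕ => if k = r then 0 else gCoeff a γ α μ k)) := by
  obtain ⟨hp, hμ0⟩ := max_lt_iff.mp hμ
  have hμ' : γ + 1 < α * μ := by rw [div_lt_iff₀ hα] at hp; linarith
  have hGμ := (Real.Gamma_pos_of_pos hμ0).ne'
  -- an order `M` of the Euler–Maclaurin formula sufficient for an expansion to order `N`
  have hMex (N : ℕ) : ∃ M : ℕ, M ≠ 0 ∧ γ + α * N - M < -1 ∧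
      ∀ k < N, γ + α * k < M - 1 := by
    obtain ⟨M, hM⟩ := exists_nat_gt (γ + α * N + 1)
    refine ⟨M + 1, M.succ_ne_zero, by push_cast; linarith, fun k hk => ?_⟩
    have : α * k ≤ α * N := by gcongr
    push_cast
    linarith
  refine ⟨fun x hx => summable_gTerm ha hμ0.le hμ' hx, fun hr => ?_, fun r hr => ?_⟩
  · obtain ⟨N₀, hN₀⟩ := exists_nat_gt (-((γ + 1) / α))
    refine hasAsymptoticPowerSeries_of_le N₀ fun N hN => ?_
    have hNr : (N₀ : ℝ) ≤ N := by exact_mod_cast hN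
    have hpN : 0 < (γ + 1) / α + N := by linarith
    obtain ⟨M, hM0, hM, hMk⟩ := hMex N
    obtain ⟨C, hC⟩ := exists_norm_gSeries_sub_le ha hα hμ0 hp hpN hM0 hM
      (tendsto_betaTailReg_of_ne hμ0 hp hpN fun r h => hr r (by linarith))
    refine ⟨C, fun x hx => le_of_eq_of_le (congrArg _ ?_) (hC x hx)⟩
    congr 1
    · rw [Complex.ofReal_sub]
      congr 2
      field_simp
    · refine Finset.sum_congr rfl fun k hk => ?_
      rw [emConst_sub_powPrimitive ha hα hx hM0 (hMk k (Finset.mem_range.mp hk))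
        (fun h => hr k (by linarith)), gCoeff_eq, mul_assoc]
  · refine hasAsymptoticPowerSeries_of_le (r + 1) fun N hN => ?_
    have hrN : (r : ℝ) < N := by exact_mod_cast hN
    have hpr : (γ + 1) / α = -r := by linarith
    obtain ⟨M, hM0, hM, hMk⟩ := hMex N
    obtain ⟨C, hC⟩ := exists_norm_gSeries_sub_le ha hα hμ0 hp (by linarith) hM0 hM
      (by rw [hpr]; exact tendsto_betaTailReg_neg_natCast hμ0 hN)
    refine ⟨C, fun x hx => le_of_eq_of_le (congrArg _ ?_) (hC x hx)⟩
    have hmem : r ∈ Finset.range N := Finset.mem_range.mpr hN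
    rw [← Finset.add_sum_erase _ _ hmem, ← Finset.add_sum_erase (Finset.range N)
      (fun k : ℕ => (negBinomCoeff μ k : ℂ) * _) hmem, if_pos rfl,
      emConst_sub_powPrimitive_pole ha hα hx hM0 hr]
    have hsum : ∑ k ∈ (Finset.range N).erase r,
        (if k = r then 0 else gCoeff a γ α μ k) * (x : ℂ) ^ k =
        ∑ k ∈ (Finset.range N).erase r, (negBinomCoeff μ k : ℂ) *
        ((x : ℂ) ^ k * emConst M (fun j => cutoffPow α j ((γ + α * k : ℝ) : ℂ) 0 0) a -
          ((x ^ (-((γ + 1) / α)) / α * powPrimitive ((γ + 1) / α + k) (x * a ^ α) : ℝ) : ℂ)) := by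
      refine Finset.sum_congr rfl fun k hk => ?_
      rw [Finset.mem_erase, Finset.mem_range] at hk
      rw [if_neg hk.1, emConst_sub_powPrimitive ha hα hx hM0 (hMk k hk.2) (fun h => hk.1 ?_),
        gCoeff_eq, mul_assoc]
      rw [hpr] at h
      exact_mod_cast (by linarith : (k : ℝ) = r)
    rw [hsum, hr, Real.rpow_natCast, zero_mul, zero_add, ← sub_sub]
    congr 1
    rw [← Complex.ofReal_mul, ← Complex.ofReal_sub, ← Complex.ofReal_sub]
    congr 1
    have hGr : Real.Gamma (r + 1) = r.factorial := Real.Gamma_nat_eq_factorial r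
    have hf : (r.factorial : ℝ) ≠ 0 := by exact_mod_cast r.factorial_ne_zero
    have hGμr := (Real.Gamma_pos_of_pos (by positivity : 0 < μ + r)).ne'
    have hGa := (Real.Gamma_pos_of_pos ha).ne'
    simp only [negBinomCoeff, hGr]
    field_simp
    ring
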